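/- **Theorem 2 (Optimality).** Let $\rho$ be a density matrix on $\mathbb{C}^d$. For a change point $\nu\in\{0,1,2,\dots\}\cup\{\infty\}$ and a post-change density matrix $\sigma\neq\rho$, consider the sequence of systems whose $i$-th member is in state $\rho$ if $i\le\nu$ and in state $\sigma$ if $i>\nu$. A *sequential strategy* starts with a quantum memory in some initial state; at step $i$ it applies to the $i$-th system together with the memory a quantum instrument (a family $(\mathcal M_x)_x$ of completely positive maps with discrete outcomes $x$ and trace-preserving sum), which may depend on all previous outcomes, records the outcome $X_i$, and keeps the post-measurement state as the new memory (the memory has finite dimension, which is arbitrary and may depend on the record); the record $X^i=(X_1,\dots,X_i)$ determines whether it stops at step $i$. Adaptive, collective and weak measurements are thus included. Let $T\in\{1,2,\dots\}\cup\{\infty\}$ be the step at which it stops, let $P_\nu,\mathbb E_\nu$ refer to the change point $\nu$, and put $$\bar T_{\mathrm{FA}}=\mathbb E_\infty[T],\qquad \bar\tau=\sup_{\nu\ge 0}\mathbb E_\nu[T-\nu\mid T>\nu],\qquad \bar\tau^\star=\sup_{\nu\ge0}\ \sup_{x^\nu:\,P_\infty(X^\nu=x^\nu)>0}\mathbb E_\nu[T-\nu\mid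 T>\nu,\,X^\nu=x^\nu],$$ where $0\le\nu<\infty$ and the suprema run over the cases in which the event conditioned on has positive probability. Let $D(\sigma\|\rho)=\mathrm{tr}[\sigma(\log\sigma-\log\rho)]$ if $\mathrm{supp}\,\sigma\subseteq\mathrm{supp}\,\rho$, and $D(\sigma\|\rho)=\infty$ otherwise. (a) Let $\sigma\ne\rho$ be a density matrix on $\mathbb{C}^d$ with $D(\sigma\|\rho)<\infty$, and let $\epsilon>0$. There is a function $\delta:\mathbb R\to\mathbb R$ with $\delta(t)\to0$ as $t\to\infty$, depending only on $\rho,\sigma,\epsilon$, such that every sequential strategy and every real $t\ge1$ with $\bar T_{\mathrm{FA}}\ge t$ satisfy $$\bar\tau^\star\ \ge\ \bar\tau\ \ge\ (1-\epsilon)\,\frac{\log t}{D(\sigma\|\rho)}\,(1+\delta(t)).$$ In particular, if $\bar T_{\mathrm{FA}}<\infty$, then $\bar\tau^\star\ge\bar\tau\ge(1-\epsilon)\frac{\log\bar T_{\mathrm{FA}}}{D(\sigma\|\rho)}(1+o(1))$ as $\bar T_{\mathrm{FA}}\to\infty$, uniformly over all strategies. (b) Let $\mathcal S$ be a finite non-empty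 set of density matrices $\sigma\neq\rho$ on $\mathbb{C}^d$ with $D(\sigma\|\rho)<\infty$, and let $\epsilon>0$. Write $\bar\tau_\sigma,\bar\tau^\star_\sigma$ for the delays with post-change state $\sigma$; the strategy does not depend on $\sigma$. There is $\delta:\mathbb R\to\mathbb R$ with $\delta(t)\to0$ as $t\to\infty$, depending only on $\rho,\mathcal S,\epsilon$, such that every sequential strategy and every real $t\ge1$ with $\bar T_{\mathrm{FA}}\ge t$ satisfy $$\max_{\sigma\in\mathcal S}\bar\tau^\star_\sigma\ \ge\ \max_{\sigma\in\mathcal S}\bar\tau_\sigma\ \ge\ (1-\epsilon)\,\frac{\log t}{\min_{\sigma\in\mathcal S}D(\sigma\|\rho)}\,(1+\delta(t)).$$ -/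

import Mathlib

open scoped Matrix Kronecker ENNReal Topology ComplexOrder

namespace QuantumChangePoint

/-- `ρ` is a quantum state (density matrix). -/
structure IsState {n : Type} [Fintype n] (ρ : Matrix n n ℂ) : Prop where
  posSemidef : ρ.PosSemidef
  trace_eq_one : ρ.trace = 1

open Classical in
/-- The quantum relative entropy `D(σ‖ρ) = tr[σ (log σ - log ρ)]` (natural logarithm), equal to `+∞`
unless `supp σ ⊆ supp ρ`, that is, unless `ker ρ ⊆ ker σ`. The matrix logarithm is taken through the
functional calculus with `log 0 = 0`, so it vanishes on the kernel. -/
noncomputable def relEntropy {n : Type} [Fintype n] [DecidableEq n] (σ ρ : Matrix n n ℂ) : EReal :=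
  if ∀ v : n → ℂ, ρ *ᵥ v = 0 → σ *ᵥ v = 0 then
    (((σ * (cfc Real.log σ - cfc Real.log ρ)).trace.re : ℝ) : EReal)
  else ⊤

/-- Complete positivity of a linear map `Φ` between matrix algebras: for every `k`, the map
`id_k ⊗ Φ` sends positive semidefinite matrices to positive semidefinite matrices. -/
def IsCompletelyPositive {a b : Type} [Fintype a] [Fintype b]
    (Φ : Matrix a a ℂ →ₗ[ℂ] Matrix b b ℂ) : Prop :=
  ∀ (k : ℕ) (A : Matrix (Fin k × a) (Fin k × a) ℂ), A.PosSemidef →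
    (Matrix.of fun p q : Fin k × b =>
      Φ (Matrix.of fun s t : a => A (p.1, s) (q.1, t)) p.2 q.2).PosSemidef

/-- A quantum instrument with outcomes in `X`: completely positive maps `Φ x` whose sum preserves
the trace. The output system may depend on the (classically known) outcome. -/
structure IsInstrument {X : Type} {a : Type} [Fintype a] {b : X → ℕ}
    (Φ : (x : X) → Matrix a a ℂ →ₗ[ℂ] Matrix (Fin (b x)) (Fin (b x)) ℂ) : Prop where
  completelyPositive : ∀ x, IsCompletelyPositive (Φ x)
  tracePreserving : ∀ A : Matrix a a ℂ, HasSum (fun x => (Φ x A).trace) A.trace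

/-- A sequential strategy for a stream of `d`-dimensional systems, with discrete outcomes in `X`.

The measurement record `x₁, …, xₙ` is kept as the list `[xₙ, …, x₁]`, newest outcome first. After
the record `h` there is a quantum memory of dimension `mem h`; the next system is then measured
jointly with the memory by the instrument `inst h`, which may depend on the whole record. The alarm
is raised the first time that the (nonempty) record lies in `alarm`. -/
structure Strategy (d : ℕ) (X : Type) where
  mem : List X → ℕ
  init : Matrix (Fin (mem [])) (Fin (mem [])) ℂ
  init_isState : IsState init
  inst : (h : List X) → (x : X) →
    Matrix (Fin d × Fin (mem h)) (Fin d × Fin (mem h)) ℂ →ₗ[ℂ]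
      Matrix (Fin (mem (x :: h))) (Fin (mem (x :: h))) ℂ
  inst_isInstrument : ∀ h, IsInstrument (inst h)
  alarm : Set (List X)

namespace Strategy

variable {d : ℕ} {X : Type}

/-- No alarm has been raised up to and including the record: the event `T > n` for a record of
length `n`. -/
def Silent (s : Strategy d X) : List X → Prop
  | [] => True
  | x :: h => s.Silent h ∧ x :: h ∉ s.alarm

/-- The alarm is raised exactly at this record: the event `T = n` for a record of length `n`. -/
def Fires (s : Strategy d X) : List X → Prop
  | [] => False
  | x :: h => s.Silent h ∧ x :: h ∈ s.alarm

/-- The unnormalized state of the memory after a record, when the `i`-th system is in state `ρ` for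
`i ≤ ν` and in state `σ` for `i > ν`. Here `ν = ⊤` means that there is no change. -/
noncomputable def memState (s : Strategy d X) (ρ σ : Matrix (Fin d) (Fin d) ℂ) (ν : ℕ∞) :
    (h : List X) → Matrix (Fin (s.mem h)) (Fin (s.mem h)) ℂ
  | [] => s.init
  | x :: h =>
    s.inst h x ((if ((h.length + 1 : ℕ) : ℕ∞) ≤ ν then ρ else σ) ⊗ₖ s.memState ρ σ ν h)

/-- The probability `P_ν(Xⁿ = h)` of a record `h` of length `n`. -/
noncomputable def recordProb (s : Strategy d X) (ρ σ : Matrix (Fin d) (Fin d) ℂ) (ν : ℕ∞)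
    (h : List X) : ℝ≥0∞ :=
  ENNReal.ofReal (s.memState ρ σ ν h).trace.re

open Classical in
/-- The probability `P_ν(Xⁿ ∈ E)` that the record of the first `n` outcomes lies in `E`. -/
noncomputable def prob (s : Strategy d X) (ρ σ : Matrix (Fin d) (Fin d) ℂ) (ν : ℕ∞)
    (n : ℕ) (E : Set (List X)) : ℝ≥0∞ :=
  ∑' h : List X, if h.length = n ∧ h ∈ E then s.recordProb ρ σ ν h else 0

/-- `P_ν(T > n, the record starts with y)`, for `n` at least the length of `y`. Since lists run
backwards in time, "starts with `y`" is `y <:+ h`. -/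
noncomputable def probGT (s : Strategy d X) (ρ σ : Matrix (Fin d) (Fin d) ℂ) (ν : ℕ∞)
    (n : ℕ) (y : List X) : ℝ≥0∞ :=
  s.prob ρ σ ν n {h | s.Silent h ∧ y <:+ h}

/-- `P_ν(T = n, the record starts with y)`, for `n` at least the length of `y`. -/
noncomputable def probEQ (s : Strategy d X) (ρ σ : Matrix (Fin d) (Fin d) ℂ) (ν : ℕ∞)
    (n : ℕ) (y : List X) : ℝ≥0∞ :=
  s.prob ρ σ ν n {h | s.Fires h ∧ y <:+ h}

/-- The expectation under `P_ν` of `(T - k)⁺` restricted to the event that the record starts with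
`y`, where `y` has length at most `k`. The last summand is `∞ · P_ν(T = ∞, …)`, with `∞ · 0 = 0`. -/
noncomputable def expExcess (s : Strategy d X) (ρ σ : Matrix (Fin d) (Fin d) ℂ) (ν : ℕ∞)
    (k : ℕ) (y : List X) : ℝ≥0∞ :=
  (∑' m : ℕ, (m : ℝ≥0∞) * s.probEQ ρ σ ν (k + m) y) + ⊤ * ⨅ m : ℕ, s.probGT ρ σ ν (k + m) y

/-- The mean false alarm time `E_∞[T]`. With `ν = ⊤` the post-change state plays no role; `ρ` is
put in its place. -/
noncomputable def falseAlarmTime (s : Strategy d X) (ρ : Matrix (Fin d) (Fin d) ℂ) : ℝ≥0∞ :=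
  s.expExcess ρ ρ ⊤ 0 []

/-- The mean delay `sup_ν E_ν[T - ν | T > ν]`, over those `ν` for which `P_ν(T > ν) > 0`. -/
noncomputable def meanDelay (s : Strategy d X) (ρ σ : Matrix (Fin d) (Fin d) ℂ) : ℝ≥0∞ :=
  ⨆ (ν : ℕ) (_ : 0 < s.probGT ρ σ ν ν []),
    s.expExcess ρ σ ν ν [] / s.probGT ρ σ ν ν []

/-- The worst-worst case mean delay `sup_ν sup_y E_ν[T - ν | T > ν, X^ν = y]`, over the records `y`
of length `ν` with `P_∞(X^ν = y) > 0` for which the event conditioned on has positive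
probability (that is, no alarm has been raised along `y`). -/
noncomputable def worstMeanDelay (s : Strategy d X) (ρ σ : Matrix (Fin d) (Fin d) ℂ) : ℝ≥0∞ :=
  ⨆ (ν : ℕ) (y : List X) (_ : y.length = ν) (_ : 0 < s.recordProb ρ σ ⊤ y)
    (_ : 0 < s.probGT ρ σ ν ν y),
    s.expExcess ρ σ ν ν y / s.probGT ρ σ ν ν y

end Strategy

end QuantumChangePoint

/-! Once a record of length `ν` is fixed, the next `m` steps are one adaptive collective measurement
on `m` fresh systems with the memory as ancilla: each continuation has as probability a positive
linear functional of the joint state of the block (`evolve`). So an operator inequality `σ^{⊗m} ≤ K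
ρ^{⊗m} + R` with `R ≥ 0` bounds the probability, under `P_ν`, that the first alarm falls in these
`m` steps by `K` times the same probability under `P_∞`, plus `tr R · P_∞(T > ν)`
(`prob_alarmWithin_le`). `exists_tensorPow_bound` supplies `K = 2 exp (m (D + ε))` with `tr R`
exponentially small, by cutting both states to typical eigenvalues.

If every window of `m` steps lost more than a fraction `q` of the silent probability, then `E_∞[T] ≤
m / q`. So when `E_∞[T] ≥ t` some `ν` has conditional false alarm probability at most `q = 2m / t`
in its window (`exists_unlikely_alarmWithin`). With `m = ⌊(1 - ε) log t / D⌋` and a small enough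
slack in `K`, both `K q` and `tr R` tend to zero: with a change at this `ν` the strategy most likely
stays silent for `m` steps, and the delay is at least `m (1 - o(1))`. The error involves the
strategy only through `t`, whence uniformity. For a finite family, the single-state bound is applied
to the member of least relative entropy. -/

namespace QuantumChangePoint

/-! ### Sums over records of a fixed length -/

section RecordSums

variable {X : Type}

open Classical in
/-- The sum of `f` over all records of length `n`. -/
noncomputable def recSum (n : ℕ) (f : List X → ℝ≥0∞) : ℝ≥0∞ :=
  ∑' h : List X, if h.length = n then f h else 0

lemma recSum_congr {n : ℕ} {f g : List X → ℝ≥0∞} (H : ∀ h, h.length = n → f h = g h) :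
    recSum n f = recSum n g := by
  unfold recSum
  refine tsum_congr fun h => ?_
  split_ifs with hh
  · exact H h hh
  · rfl

lemma recSum_mono {n : ℕ} {f g : List X → ℝ≥0∞} (H : ∀ h, h.length = n → f h ≤ g h) :
    recSum n f ≤ recSum n g := by
  unfold recSum
  refine ENNReal.tsum_le_tsum fun h => ?_
  split_ifs with hh
  · exact H h hh
  · rfl

lemma recSum_add_fun (n : ℕ) (f g : List X → ℝ≥0∞) :
    recSum n (fun h => f h + g h) = recSum n f + recSum n g := by
  unfold recSum
  rw [← ENNReal.tsum_add]
  refine tsum_congr fun h => ?_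
  split_ifs <;> simp

lemma recSum_const_mul (n : ℕ) (c : ℝ≥0∞) (f : List X → ℝ≥0∞) :
    recSum n (fun h => c * f h) = c * recSum n f := by
  unfold recSum
  rw [← ENNReal.tsum_mul_left]
  refine tsum_congr fun h => ?_
  split_ifs <;> simp

lemma recSum_sum {ι : Type*} (n : ℕ) (t : Finset ι) (f : ι → List X → ℝ≥0∞) :
    recSum n (fun h => ∑ i ∈ t, f i h) = ∑ i ∈ t, recSum n (f i) := by
  classical
  induction t using Finset.induction_on with
  | empty => simp [recSum]
  | insert a t ha ih => simp only [Finset.sum_insert ha, recSum_add_fun, ih]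

lemma recSum_tsum {ι : Type*} (n : ℕ) (f : ι → List X → ℝ≥0∞) :
    recSum n (fun h => ∑' i, f i h) = ∑' i, recSum n (f i) := by
  unfold recSum
  rw [ENNReal.tsum_comm]
  refine tsum_congr fun h => ?_
  split_ifs <;> simp

lemma recSum_comm (m n : ℕ) (f : List X → List X → ℝ≥0∞) :
    recSum m (fun y => recSum n (fun h => f y h)) = recSum n (fun h => recSum m fun y => f y h) := by
  have : ∀ y, recSum n (fun h => f y h) = ∑' h, if h.length = n then f y h else 0 := fun y => rfl
  simp only [this, recSum_tsum]
  refine tsum_congr fun h => ?_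
  by_cases hh : h.length = n <;> simp [hh, recSum]

lemma recSum_zero (f : List X → ℝ≥0∞) : recSum 0 f = f [] := by
  unfold recSum
  rw [tsum_eq_single []]
  · simp
  · intro h hh
    simp [hh]

lemma recSum_succ (n : ℕ) (f : List X → ℝ≥0∞) :
    recSum (n + 1) f = recSum n (fun h => ∑' x, f (x :: h)) := by
  unfold recSum
  have hinj : Function.Injective (fun p : List X × X => p.2 :: p.1) := by
    rintro ⟨a, x⟩ ⟨b, y⟩ h
    simp only [List.cons.injEq] at h
    simp [h.1, h.2]
  rw [← hinj.tsum_eq, ENNReal.tsum_prod']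
  · refine tsum_congr fun h => ?_
    simp only [List.length_cons, Nat.add_right_cancel_iff]
    split_ifs <;> simp
  · intro h hh
    cases h with
    | nil => simp at hh
    | cons x h => exact ⟨(h, x), rfl⟩

/-- Records run newest first, so the `m` later outcomes `g` stand in front of the earlier record
`h`. -/
lemma recSum_add (m n : ℕ) (f : List X → ℝ≥0∞) :
    recSum (n + m) f = recSum n (fun h => recSum m (fun g => f (g ++ h))) := by
  induction m generalizing f with
  | zero => simp [recSum_zero]
  | succ m ih =>
    rw [← add_assoc, recSum_succ, ih]
    refine recSum_congr fun h _ => ?_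
    rw [recSum_succ]
    rfl

end RecordSums

/-! ### Complete positivity with an arbitrary finite ancilla -/

section Ampliation

variable {R a b : Type}

/-- The map `id_R ⊗ Φ`. -/
noncomputable def ampliate (R : Type) (Φ : Matrix a a ℂ →ₗ[ℂ] Matrix b b ℂ) :
    Matrix (R × a) (R × a) ℂ →ₗ[ℂ] Matrix (R × b) (R × b) ℂ where
  toFun A := Matrix.of fun p q => Φ (Matrix.of fun s t => A (p.1, s) (q.1, t)) p.2 q.2
  map_add' A B := by
    ext p q
    have : (Matrix.of fun s t => (A + B) (p.1, s) (q.1, t)) =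
      (Matrix.of fun s t => A (p.1, s) (q.1, t)) + (Matrix.of fun s t => B (p.1, s) (q.1, t)) := rfl
    rw [Matrix.of_apply, this, map_add]
    rfl
  map_smul' c A := by
    ext p q
    have : (Matrix.of fun s t => (c • A) (p.1, s) (q.1, t)) =
      c • (Matrix.of fun s t => A (p.1, s) (q.1, t)) := rfl
    rw [Matrix.of_apply, this, map_smul]
    rfl

lemma ampliate_apply (Φ : Matrix a a ℂ →ₗ[ℂ] Matrix b b ℂ) (A : Matrix (R × a) (R × a) ℂ)
    (p q : R × b) :
    ampliate R Φ A p q = Φ (Matrix.of fun s t => A (p.1, s) (q.1, t)) p.2 q.2 := rfl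

lemma ampliate_kronecker (Φ : Matrix a a ℂ →ₗ[ℂ] Matrix b b ℂ) (A : Matrix R R ℂ)
    (B : Matrix a a ℂ) : ampliate R Φ (A ⊗ₖ B) = A ⊗ₖ Φ B := by
  ext p q
  rw [ampliate_apply]
  have : (Matrix.of fun s t => (A ⊗ₖ B) (p.1, s) (q.1, t)) = A p.1 q.1 • B := by
    ext s t
    simp [Matrix.kroneckerMap_apply]
  rw [this]
  simp [Matrix.kroneckerMap_apply]

lemma IsCompletelyPositive.ampliate_posSemidef [Fintype R] [Fintype a] [Fintype b]
    {Φ : Matrix a a ℂ →ₗ[ℂ] Matrix b b ℂ} (hΦ : IsCompletelyPositive Φ)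
    {A : Matrix (R × a) (R × a) ℂ} (hA : A.PosSemidef) : (ampliate R Φ A).PosSemidef := by
  have e := Fintype.equivFin R
  have h := hΦ _ _ (hA.submatrix (fun p : Fin (Fintype.card R) × a => (e.symm p.1, p.2)))
  have h' := h.submatrix (fun p : R × b => (e p.1, p.2))
  convert h' using 1
  ext p q
  simp [ampliate_apply]

lemma posSemidef_of_ampliate_unit {Φ : Matrix a a ℂ →ₗ[ℂ] Matrix b b ℂ}
    (hΦ : ∀ A : Matrix (Unit × a) (Unit × a) ℂ, A.PosSemidef → (ampliate Unit Φ A).PosSemidef)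
    {A : Matrix a a ℂ} (hA : A.PosSemidef) : (Φ A).PosSemidef :=
  (hΦ _ (hA.submatrix (fun p : Unit × a => p.2))).submatrix (fun i : b => ((), i))

lemma IsCompletelyPositive.posSemidef [Fintype a] [Fintype b]
    {Φ : Matrix a a ℂ →ₗ[ℂ] Matrix b b ℂ} (hΦ : IsCompletelyPositive Φ)
    {A : Matrix a a ℂ} (hA : A.PosSemidef) : (Φ A).PosSemidef :=
  posSemidef_of_ampliate_unit (fun _ h => hΦ.ampliate_posSemidef h) hA

lemma IsInstrument.tsum_trace {Y : Type} [Fintype a] {m : Y → ℕ}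
    {Φ : (x : Y) → Matrix a a ℂ →ₗ[ℂ] Matrix (Fin (m x)) (Fin (m x)) ℂ} (hΦ : IsInstrument Φ)
    {A : Matrix a a ℂ} (hA : A.PosSemidef) :
    ∑' x, ENNReal.ofReal (Φ x A).trace.re = ENNReal.ofReal A.trace.re := by
  have h := Complex.hasSum_re (hΦ.tracePreserving A)
  rw [← h.tsum_eq, ENNReal.ofReal_tsum_of_nonneg _ h.summable]
  intro x
  exact (Complex.nonneg_iff.1 ((hΦ.completelyPositive x).posSemidef hA).trace_nonneg).1

end Ampliation

/-! ### Consistency of the record probabilities -/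

namespace Strategy

variable {d : ℕ} {X : Type} {s : Strategy d X} {ρ σ : Matrix (Fin d) (Fin d) ℂ}

lemma memState_posSemidef (hρ : IsState ρ) (hσ : IsState σ) (ν : ℕ∞) (h : List X) :
    (s.memState ρ σ ν h).PosSemidef := by
  induction h with
  | nil => exact s.init_isState.posSemidef
  | cons x h ih =>
    refine ((s.inst_isInstrument h).completelyPositive x).posSemidef ?_
    refine Matrix.PosSemidef.kronecker ?_ ih
    split_ifs
    · exact hρ.posSemidef
    · exact hσ.posSemidef

lemma tsum_recordProb_cons (hρ : IsState ρ) (hσ : IsState σ) (ν : ℕ∞) (h : List X) :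
    ∑' x, s.recordProb ρ σ ν (x :: h) = s.recordProb ρ σ ν h := by
  unfold recordProb
  simp only [memState]
  rw [(s.inst_isInstrument h).tsum_trace, Matrix.trace_kronecker]
  · split_ifs
    · rw [hρ.trace_eq_one, one_mul]
    · rw [hσ.trace_eq_one, one_mul]
  · refine Matrix.PosSemidef.kronecker ?_ (memState_posSemidef hρ hσ ν h)
    split_ifs
    · exact hρ.posSemidef
    · exact hσ.posSemidef

lemma memState_eq_top (ν : ℕ∞) (h : List X) (hν : (h.length : ℕ∞) ≤ ν) :
    s.memState ρ σ ν h = s.memState ρ σ ⊤ h := by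
  induction h with
  | nil => rfl
  | cons x h ih =>
    have h1 : ((h.length + 1 : ℕ) : ℕ∞) ≤ ν := hν
    simp only [memState, if_pos h1, le_top, if_true]
    rw [ih (le_trans (by exact_mod_cast Nat.le_succ _) h1)]

lemma memState_top (σ' : Matrix (Fin d) (Fin d) ℂ) (h : List X) :
    s.memState ρ σ ⊤ h = s.memState ρ σ' ⊤ h := by
  induction h with
  | nil => rfl
  | cons x h ih => simp only [memState, le_top, if_true, ih]

lemma recSum_recordProb (hρ : IsState ρ) (hσ : IsState σ) (ν : ℕ∞) (n : ℕ) :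
    recSum n (s.recordProb ρ σ ν) = 1 := by
  induction n with
  | zero => simp [recSum_zero, recordProb, memState, s.init_isState.trace_eq_one]
  | succ n ih => simp only [recSum_succ, tsum_recordProb_cons hρ hσ, ih]

open Classical in
lemma prob_eq (ν : ℕ∞) (n : ℕ) (E : Set (List X)) :
    s.prob ρ σ ν n E = recSum n (fun h => if h ∈ E then s.recordProb ρ σ ν h else 0) := by
  unfold prob recSum
  refine tsum_congr fun h => ?_
  by_cases h1 : h.length = n <;> by_cases h2 : h ∈ E <;> simp [h1, h2]

lemma prob_le_one (hρ : IsState ρ) (hσ : IsState σ) (ν : ℕ∞) (n : ℕ) (E : Set (List X)) :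
    s.prob ρ σ ν n E ≤ 1 := by
  classical
  rw [prob_eq, ← recSum_recordProb (s := s) hρ hσ ν n]
  refine recSum_mono fun h _ => ?_
  split_ifs <;> simp

/-- A silent record is extended by one outcome, which either raises the alarm or does not. The bound
on the length of `y` ensures that the extension cannot newly create the initial segment `y`. -/
lemma probGT_eq_add (hρ : IsState ρ) (hσ : IsState σ) (ν : ℕ∞) (n : ℕ) (y : List X)
    (hy : y.length ≤ n) :
    s.probGT ρ σ ν n y = s.probEQ ρ σ ν (n + 1) y + s.probGT ρ σ ν (n + 1) y := by
  classical
  unfold probGT probEQ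
  simp only [prob_eq, Set.mem_ofPred_eq]
  rw [← recSum_add_fun, recSum_succ]
  refine recSum_congr fun h hh => ?_
  have hsuf : ∀ x, y <:+ x :: h ↔ y <:+ h := by
    intro x
    rw [List.suffix_cons_iff]
    refine ⟨?_, Or.inr⟩
    rintro (h1 | h1)
    · simp [h1] at hy
      omega
    · exact h1
  simp only [hsuf, Silent, Fires]
  by_cases h1 : s.Silent h <;> by_cases h2 : y <:+ h <;> simp only [h1, h2, true_and, and_true,
    and_false, false_and, if_true, if_false, add_zero, tsum_zero]
  rw [← tsum_recordProb_cons hρ hσ]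
  refine tsum_congr fun x => ?_
  by_cases h3 : x :: h ∈ s.alarm <;> simp [h3]

lemma probGT_antitone (hρ : IsState ρ) (hσ : IsState σ) (ν : ℕ∞) (k : ℕ) (y : List X)
    (hy : y.length ≤ k) : Antitone fun n => s.probGT ρ σ ν (k + n) y := by
  refine antitone_nat_of_succ_le fun n => ?_
  change s.probGT ρ σ ν (k + n + 1) y ≤ s.probGT ρ σ ν (k + n) y
  rw [probGT_eq_add hρ hσ ν (k + n) y (by omega)]
  exact le_add_self

end Strategy

/-- Summation by parts: `∑ m e m = ∑ a n` when `e (n + 1)` is the decrement of `a`. -/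
lemma tsum_mul_decrement {a e : ℕ → ℝ≥0∞} (h : ∀ n, a n = e (n + 1) + a (n + 1)) :
    (∑' m : ℕ, (m : ℝ≥0∞) * e m) + ⊤ * ⨅ n, a n = ∑' n, a n := by
  have hanti : Antitone a := antitone_nat_of_succ_le fun n => by rw [h n]; exact le_add_self
  have hlim : Filter.Tendsto a Filter.atTop (𝓝 (⨅ n, a n)) := tendsto_atTop_iInf hanti
  by_cases h0 : (⨅ n, a n) = 0
  · rw [h0] at hlim ⊢
    rw [mul_zero, add_zero]
    -- The decrements telescope, and nothing is left over because the limit of `a` is zero. It then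
    -- remains to exchange the order of summation.
    have tail : ∀ n, ∑' k, e (n + k + 1) = a n := by
      intro n
      have hp : ∀ N, ∑ k ∈ Finset.range N, e (n + k + 1) + a (n + N) = a n := by
        intro N
        induction N with
        | zero => simp
        | succ N ih =>
          rw [Finset.sum_range_succ, add_assoc, ← ih, h (n + N)]
          rfl
      have h1 := (ENNReal.tendsto_nat_tsum (fun k => e (n + k + 1))).add
        (hlim.comp (Filter.tendsto_add_atTop_nat n))
      rw [add_zero] at h1
      refine tendsto_nhds_unique h1 ?_
      refine tendsto_const_nhds.congr fun N => ?_
      simp only [Function.comp]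
      rw [add_comm N n, hp N]
    calc ∑' m : ℕ, (m : ℝ≥0∞) * e m
        = ∑' m : ℕ, ∑' n : ℕ, if n < m then e m else 0 := by
          refine tsum_congr fun m => ?_
          rw [tsum_eq_sum (s := Finset.range m) (by simp +contextual)]
          rw [Finset.sum_congr rfl (fun n hn => if_pos (Finset.mem_range.1 hn))]
          simp
      _ = ∑' n : ℕ, ∑' m : ℕ, if n < m then e m else 0 := ENNReal.tsum_comm
      _ = ∑' n, a n := by
          refine tsum_congr fun n => ?_
          rw [← tail n]
          have hinj : Function.Injective (fun k : ℕ => n + k + 1) := by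
            intro x y hxy
            simpa using hxy
          rw [← hinj.tsum_eq]
          · refine tsum_congr fun k => if_pos (by omega)
          · intro m hm
            have : n < m := by
              by_contra hc
              simp [hc] at hm
            exact ⟨m - n - 1, by simp; omega⟩
  -- With a positive limit both sides are infinite, since a series with finite sum has terms tending
  -- to zero.
  · rw [ENNReal.top_mul h0, add_top, eq_comm]
    by_contra hne
    have := ENNReal.tendsto_atTop_zero_of_tsum_ne_top hne
    exact h0 (tendsto_nhds_unique hlim this)

/-! ### Delays as tail sums; comparison of the two delay criteria -/

namespace Strategy

variable {d : ℕ} {X : Type} {s : Strategy d X} {ρ σ : Matrix (Fin d) (Fin d) ℂ}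

lemma expExcess_eq_tsum (hρ : IsState ρ) (hσ : IsState σ) (ν : ℕ∞) (k : ℕ) (y : List X)
    (hy : y.length ≤ k) :
    s.expExcess ρ σ ν k y = ∑' n, s.probGT ρ σ ν (k + n) y := by
  unfold expExcess
  exact tsum_mul_decrement fun n => probGT_eq_add hρ hσ ν (k + n) y (by omega)

lemma recSum_probGT (ν : ℕ∞) (k n : ℕ) :
    recSum k (fun y => s.probGT ρ σ ν (k + n) y) = s.probGT ρ σ ν (k + n) [] := by
  classical
  unfold probGT
  simp only [prob_eq, Set.mem_ofPred_eq, List.nil_suffix, and_true]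
  rw [recSum_comm]
  refine recSum_congr fun h hl => ?_
  unfold recSum
  -- A record of length `k + n` has exactly one initial segment of length `k`, its last `k` list
  -- entries.
  rw [tsum_eq_single (h.drop n)]
  · have h1 : (h.drop n).length = k := by simp [hl]
    simp [h1, List.drop_suffix]
  · intro y hy
    by_cases hk : y.length = k
    · have : ¬ y <:+ h := by
        intro hs
        apply hy
        rw [List.suffix_iff_eq_drop] at hs
        rw [hs]
        congr 1
        omega
      simp [this]
    · simp [hk]

/-- Numerator and denominator both split over the first `ν` outcomes, so the mean delay at `ν` is an
average of the delays conditioned on `X^ν`. -/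
lemma meanDelay_le_worstMeanDelay (hρ : IsState ρ) (hσ : IsState σ) :
    s.meanDelay ρ σ ≤ s.worstMeanDelay ρ σ := by
  classical
  refine iSup_le fun ν => iSup_le fun hν => ?_
  rw [ENNReal.div_le_iff hν.ne' (ne_top_of_le_ne_top ENNReal.one_ne_top
    (prob_le_one hρ hσ _ _ _))]
  rw [expExcess_eq_tsum hρ hσ _ _ _ (by simp)]
  simp only [← recSum_probGT]
  rw [← recSum_tsum]
  have := recSum_probGT (s := s) (ρ := ρ) (σ := σ) ν ν 0
  simp only [add_zero] at this
  rw [← this, ← recSum_const_mul]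
  refine recSum_mono fun y hy => ?_
  by_cases h0 : s.probGT ρ σ ν ν y = 0
  · have hz : ∀ n, s.probGT ρ σ ν (ν + n) y = 0 := by
      intro n
      refine le_antisymm ?_ (zero_le)
      rw [← h0]
      exact probGT_antitone hρ hσ ν ν y hy.le (Nat.zero_le n)
    simp [hz]
  · rw [← expExcess_eq_tsum hρ hσ _ _ _ hy.le]
    rw [← ENNReal.div_le_iff h0 (ne_top_of_le_ne_top ENNReal.one_ne_top
      (prob_le_one hρ hσ _ _ _))]
    refine le_iSup_of_le ν (le_iSup_of_le y (le_iSup_of_le hy (le_iSup_of_le ?_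
      (le_iSup_of_le (pos_iff_ne_zero.2 h0) le_rfl))))
    -- A record conditioned on must have positive probability under `P_∞`. This holds because `P_ν`
    -- and `P_∞` agree on the first `ν` outcomes.
    rw [pos_iff_ne_zero]
    intro hr
    apply h0
    unfold probGT
    rw [prob_eq]
    unfold recSum
    rw [ENNReal.tsum_eq_zero]
    intro h
    by_cases hl : h.length = ν
    · by_cases hs : y <:+ h
      · have : y = h := hs.eq_of_length (by rw [hl, hy])
        subst this
        have : s.recordProb ρ σ ν y = 0 := by
          rw [← hr]
          unfold recordProb
          rw [memState_eq_top]
          exact_mod_cast hy.le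
        simp [this]
      · simp [hs]
    · simp [hl]

end Strategy

/-! ### Tensor powers, and the evolution of a block of systems -/

section TensorPower

variable {ι : Type}

/-- The `n`-fold tensor power of a matrix. -/
def tensorPow (A : Matrix ι ι ℂ) (n : ℕ) : Matrix (Fin n → ι) (Fin n → ι) ℂ :=
  Matrix.of fun i j => ∏ l, A (i l) (j l)

/-- Reads a matrix on `ι^(n+1)` as a matrix on `ι × ι^n`. -/
def splitFirst (n : ℕ) : Matrix (Fin (n + 1) → ι) (Fin (n + 1) → ι) ℂ ≃ₗ[ℂ]
    Matrix (ι × (Fin n → ι)) (ι × (Fin n → ι)) ℂ :=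
  Matrix.reindexLinearEquiv ℂ ℂ (Fin.consEquiv fun _ => ι).symm (Fin.consEquiv fun _ => ι).symm

lemma splitFirst_apply (n : ℕ) (A : Matrix (Fin (n + 1) → ι) (Fin (n + 1) → ι) ℂ)
    (p q : ι × (Fin n → ι)) :
    splitFirst n A p q = A (Fin.cons p.1 p.2) (Fin.cons q.1 q.2) := rfl

lemma splitFirst_tensorPow (A : Matrix ι ι ℂ) (n : ℕ) :
    splitFirst n (tensorPow A (n + 1)) = A ⊗ₖ tensorPow A n := by
  ext p q
  simp [splitFirst_apply, tensorPow, Matrix.kroneckerMap_apply, Fin.prod_univ_succ]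

lemma conjTranspose_tensorPow (A : Matrix ι ι ℂ) (n : ℕ) :
    (tensorPow A n)ᴴ = tensorPow Aᴴ n := by
  ext i j
  simp [tensorPow, Matrix.conjTranspose_apply]

end TensorPower

namespace Strategy

variable {d : ℕ} {X : Type}

/-- The unnormalized memory state after the record `g ++ h₀`, as a linear function of the joint
state of the systems measured after `h₀`, when the memory is in state `τ` after `h₀`. -/
noncomputable def evolve (s : Strategy d X) (h₀ : List X)
    (τ : Matrix (Fin (s.mem h₀)) (Fin (s.mem h₀)) ℂ) : (g : List X) →
      Matrix (Fin g.length → Fin d) (Fin g.length → Fin d) ℂ →ₗ[ℂ]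
        Matrix (Fin (s.mem (g ++ h₀))) (Fin (s.mem (g ++ h₀))) ℂ
  | [] => (Matrix.traceLinearMap _ ℂ ℂ).smulRight τ
  | x :: g => (s.inst (g ++ h₀) x) ∘ₗ ampliate (Fin d) (s.evolve h₀ τ g) ∘ₗ
      (splitFirst g.length).toLinearMap

variable {s : Strategy d X} {h₀ : List X} {τ : Matrix (Fin (s.mem h₀)) (Fin (s.mem h₀)) ℂ}

lemma evolve_nil (A : Matrix (Fin 0 → Fin d) (Fin 0 → Fin d) ℂ) :
    s.evolve h₀ τ [] A = A.trace • τ := rfl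

lemma evolve_cons (x : X) (g : List X)
    (A : Matrix (Fin (g.length + 1) → Fin d) (Fin (g.length + 1) → Fin d) ℂ) :
    s.evolve h₀ τ (x :: g) A =
      s.inst (g ++ h₀) x (ampliate (Fin d) (s.evolve h₀ τ g) (splitFirst g.length A)) := rfl

/-- The ancilla `R` is quantified inside the induction: one step moves the newest system into it, so
the claim for `R` uses the claim for `R × Fin d`. -/
lemma ampliate_evolve_posSemidef (hτ : τ.PosSemidef) (g : List X) :
    ∀ {R : Type} [Fintype R]
      (A : Matrix (R × (Fin g.length → Fin d)) (R × (Fin g.length → Fin d)) ℂ),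
      A.PosSemidef → (ampliate R (s.evolve h₀ τ g) A).PosSemidef := by
  induction g with
  | nil =>
    intro R _ A hA
    -- This is the partial trace over the empty block; its index set has a single element.
    have h1 : (∑ i : Fin 0 → Fin d, A.submatrix (fun r : R => (r, i)) fun r => (r, i)).PosSemidef :=
      Matrix.posSemidef_sum _ fun i _ => hA.submatrix _
    have h2 : ampliate R (s.evolve h₀ τ []) A =
        (∑ i : Fin 0 → Fin d, A.submatrix (fun r : R => (r, i)) fun r => (r, i)) ⊗ₖ τ := by
      refine Matrix.ext fun p q => ?_
      have : ampliate R (s.evolve h₀ τ []) A p q =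
        ((Matrix.of fun s t => A (p.1, s) (q.1, t)).trace • τ) p.2 q.2 := rfl
      rw [this]
      simp [Matrix.kroneckerMap_apply, Matrix.trace]
    rw [h2]
    exact h1.kronecker hτ
  | cons x g ih =>
    intro R _ A hA
    let f : (R × Fin d) × (Fin g.length → Fin d) → R × (Fin (g.length + 1) → Fin d) :=
      fun p => (p.1.1, Fin.cons p.1.2 p.2)
    have h1 := ih _ (hA.submatrix f)
    have h2 := h1.submatrix (Equiv.prodAssoc R (Fin d) (Fin (s.mem (g ++ h₀)))).symm
    exact ((s.inst_isInstrument (g ++ h₀)).completelyPositive x).ampliate_posSemidef h2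

lemma evolve_posSemidef (hτ : τ.PosSemidef) (g : List X)
    {A : Matrix (Fin g.length → Fin d) (Fin g.length → Fin d) ℂ} (hA : A.PosSemidef) :
    (s.evolve h₀ τ g A).PosSemidef :=
  posSemidef_of_ampliate_unit (fun B hB => ampliate_evolve_posSemidef hτ g B hB) hA

/-- Total probability for an arbitrary positive block operator, later applied to the remainder `R`.
Summing over the newest outcome removes its instrument and leaves the partial trace over the newest
system. `A` is a family over all `n` because the type of `evolve` depends on `g.length`. -/
lemma recSum_trace_evolve (hτ : τ.PosSemidef) (m : ℕ) :
    ∀ A : (n : ℕ) → Matrix (Fin n → Fin d) (Fin n → Fin d) ℂ, (∀ n, (A n).PosSemidef) →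
      recSum m (fun g => ENNReal.ofReal (s.evolve h₀ τ g (A g.length)).trace.re) =
        ENNReal.ofReal (A m).trace.re * ENNReal.ofReal τ.trace.re := by
  have hnn : ∀ {n : Type} [Fintype n] {B : Matrix n n ℂ}, B.PosSemidef → 0 ≤ B.trace.re :=
    fun hB => (Complex.nonneg_iff.1 hB.trace_nonneg).1
  have him : ∀ {n : Type} [Fintype n] {B : Matrix n n ℂ}, B.PosSemidef → B.trace.im = 0 :=
    fun hB => (Complex.nonneg_iff.1 hB.trace_nonneg).2.symm
  induction m with
  | zero =>
    intro A hA
    rw [recSum_zero, ← ENNReal.ofReal_mul (hnn (hA 0))]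
    have : s.evolve h₀ τ [] (A ([] : List X).length) = (A 0).trace • τ := rfl
    rw [this, Matrix.trace_smul, smul_eq_mul, Complex.mul_re, him (hA 0)]
    simp
  | succ m ih =>
    intro A hA
    -- The diagonal blocks with respect to coordinate `0`, the newest system; their sum is the
    -- partial trace.
    let B : Fin d → (n : ℕ) → Matrix (Fin n → Fin d) (Fin n → Fin d) ℂ :=
      fun a n => (A (n + 1)).submatrix (fun i => Fin.cons a i) (fun i => Fin.cons a i)
    have hB : ∀ a n, (B a n).PosSemidef := fun a n => (hA (n + 1)).submatrix _
    have htr : (A (m + 1)).trace = ∑ a, (B a m).trace := by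
      simp only [Matrix.trace, Matrix.diag_apply, B, Matrix.submatrix_apply]
      rw [← Fintype.sum_prod_type']
      exact ((Fin.consEquiv fun _ => Fin d).sum_comp (fun i => A (m + 1) i i)).symm
    rw [recSum_succ, htr, Complex.re_sum, ENNReal.ofReal_sum_of_nonneg fun a _ => hnn (hB a m),
      Finset.sum_mul]
    simp only [← ih _ (hB _)]
    rw [← recSum_sum]
    refine recSum_congr fun g _ => ?_
    have hpos : (ampliate (Fin d) (s.evolve h₀ τ g)
        (splitFirst g.length (A (g.length + 1)))).PosSemidef :=
      ampliate_evolve_posSemidef hτ g _ ((hA (g.length + 1)).submatrix _)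
    refine ((s.inst_isInstrument (g ++ h₀)).tsum_trace hpos).trans ?_
    rw [← ENNReal.ofReal_sum_of_nonneg fun a _ => hnn (evolve_posSemidef hτ g (hB a _)),
      ← Complex.re_sum]
    congr 2
    simp only [Matrix.trace, Matrix.diag_apply]
    rw [Fintype.sum_prod_type]
    rfl

/-- With the change at `h₀.length`, every system of the block is in state `σ`, so a product input
reproduces the step-by-step recursion. -/
lemma evolve_tensorPow (ρ σ : Matrix (Fin d) (Fin d) ℂ) (g : List X) :
    s.evolve h₀ (s.memState ρ σ h₀.length h₀) g (tensorPow σ g.length) =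
      s.memState ρ σ h₀.length (g ++ h₀) := by
  induction g with
  | nil => exact (evolve_nil _).trans (by simp [tensorPow, Matrix.trace])
  | cons x g ih =>
    have h1 : ¬ (((g ++ h₀).length + 1 : ℕ) : ℕ∞) ≤ h₀.length := by
      rw [Nat.cast_le]
      simp
    refine (evolve_cons x g _).trans ?_
    have h2 (A : Matrix (Fin d) (Fin d) ℂ) :
        splitFirst g.length (tensorPow A (x :: g).length) = A ⊗ₖ tensorPow A g.length :=
      splitFirst_tensorPow A g.length
    rw [h2, ampliate_kronecker, ih]
    change _ = s.inst (g ++ h₀) x (_ ⊗ₖ s.memState ρ σ h₀.length (g ++ h₀))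
    rw [if_neg]
    exact h1

lemma evolve_tensorPow_top (ρ σ : Matrix (Fin d) (Fin d) ℂ) (g : List X) :
    s.evolve h₀ (s.memState ρ σ ⊤ h₀) g (tensorPow ρ g.length) = s.memState ρ σ ⊤ (g ++ h₀) := by
  induction g with
  | nil => exact (evolve_nil _).trans (by simp [tensorPow, Matrix.trace])
  | cons x g ih =>
    refine (evolve_cons x g _).trans ?_
    have h2 (A : Matrix (Fin d) (Fin d) ℂ) :
        splitFirst g.length (tensorPow A (x :: g).length) = A ⊗ₖ tensorPow A g.length :=
      splitFirst_tensorPow A g.length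
    rw [h2, ampliate_kronecker, ih]
    change _ = s.inst (g ++ h₀) x (_ ⊗ₖ s.memState ρ σ ⊤ (g ++ h₀))
    rw [if_pos]
    exact le_top

end Strategy

lemma _root_.Matrix.PosSemidef.zero_le_trace_re {N : Type} [Fintype N] {A : Matrix N N ℂ}
    (hA : A.PosSemidef) : 0 ≤ A.trace.re :=
  (Complex.nonneg_iff.1 hA.trace_nonneg).1

/-! ### An operator inequality from typical spectral subspaces -/

section UnitaryConjugation

variable {N : Type} [Fintype N] [DecidableEq N]

/-- The matrix with eigenvalues `f` and eigenvectors the columns of `U`. -/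
noncomputable def diagConj (U : Matrix N N ℂ) (f : N → ℝ) : Matrix N N ℂ :=
  U * Matrix.diagonal (fun i => (f i : ℂ)) * Uᴴ

lemma diagConj_posSemidef (U : Matrix N N ℂ) {f : N → ℝ} (hf : ∀ i, 0 ≤ f i) :
    (diagConj U f).PosSemidef := by
  refine Matrix.PosSemidef.mul_mul_conjTranspose_same ?_ U
  refine Matrix.PosSemidef.diagonal fun i => ?_
  exact Complex.zero_le_real.2 (hf i)

lemma conjTranspose_diagConj (U : Matrix N N ℂ) (f : N → ℝ) : (diagConj U f)ᴴ = diagConj U f := by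
  have : star (fun i => (f i : ℂ)) = fun i => (f i : ℂ) := by
    ext i
    simp
  simp [diagConj, Matrix.mul_assoc, Matrix.diagonal_conjTranspose, this]

lemma diagConj_add (U : Matrix N N ℂ) (f g : N → ℝ) :
    diagConj U (f + g) = diagConj U f + diagConj U g := by
  have : (fun i => ((f + g) i : ℂ)) = fun i => (f i : ℂ) + (g i : ℂ) := by
    ext i
    simp
  rw [diagConj, this, ← Matrix.diagonal_add, Matrix.mul_add, Matrix.add_mul]
  rfl

lemma diagConj_smul (U : Matrix N N ℂ) (c : ℝ) (f : N → ℝ) :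
    diagConj U (c • f) = (c : ℂ) • diagConj U f := by
  have : (fun i => ((c • f) i : ℂ)) = (c : ℂ) • fun i => (f i : ℂ) := by
    ext i
    simp
  rw [diagConj, this, Matrix.diagonal_smul, Matrix.mul_smul, Matrix.smul_mul]
  rfl

lemma diagConj_mul {U : Matrix N N ℂ} (hU : Uᴴ * U = 1) (f g : N → ℝ) :
    diagConj U f * diagConj U g = diagConj U (f * g) := by
  have : (fun i => ((f * g) i : ℂ)) = fun i => (f i : ℂ) * (g i : ℂ) := by
    ext i
    simp
  rw [diagConj, diagConj, diagConj, this, ← Matrix.diagonal_mul_diagonal]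
  simp only [Matrix.mul_assoc]
  rw [← Matrix.mul_assoc Uᴴ U, hU, Matrix.one_mul]

lemma diagConj_one {U : Matrix N N ℂ} (hU : U * Uᴴ = 1) : diagConj U 1 = 1 := by
  simp [diagConj, hU]

lemma trace_mul_diagConj (A U : Matrix N N ℂ) (f : N → ℝ) :
    (A * diagConj U f).trace = ∑ i, (f i : ℂ) * (Uᴴ * A * U) i i := by
  rw [diagConj, ← Matrix.mul_assoc, ← Matrix.mul_assoc, Matrix.trace_mul_comm, ← Matrix.mul_assoc,
    ← Matrix.mul_assoc]
  simp [Matrix.trace, Matrix.mul_diagonal, mul_comm]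

lemma conj_diagConj {U : Matrix N N ℂ} (hU : Uᴴ * U = 1) (f : N → ℝ) :
    Uᴴ * diagConj U f * U = Matrix.diagonal fun i => (f i : ℂ) := by
  rw [diagConj]
  simp only [← Matrix.mul_assoc]
  rw [hU, Matrix.one_mul, Matrix.mul_assoc, hU, Matrix.mul_one]

lemma trace_diagConj {U : Matrix N N ℂ} (hU : Uᴴ * U = 1) (f : N → ℝ) :
    (diagConj U f).trace = ∑ i, (f i : ℂ) := by
  rw [diagConj, Matrix.mul_assoc, Matrix.trace_mul_comm, Matrix.mul_assoc, hU, Matrix.mul_one]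
  simp [Matrix.trace]

/-- If the eigenvalues of `σ` on `A` are at most `a` and those of `ρ` on `B` are at least `b`, then
`σ ≤ 2 (a / b) ρ + R`, where `R` has small trace if `σ` is nearly supported on both spectral
subspaces. -/
lemma exists_remainder_of_typical {U V : Matrix N N ℂ} (hU : Uᴴ * U = 1) (hU' : U * Uᴴ = 1)
    (hV : Vᴴ * V = 1) (hV' : V * Vᴴ = 1) {P Q : N → ℝ} (hP : ∀ i, 0 ≤ P i) (hQ : ∀ i, 0 ≤ Q i)
    (A B : N → Prop) [DecidablePred A] [DecidablePred B] {a b : ℝ} (ha : 0 ≤ a) (hb : 0 < b)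
    (hA : ∀ i, A i → P i ≤ a) (hB : ∀ i, B i → b ≤ Q i) :
    ∃ R : Matrix N N ℂ, R.PosSemidef ∧
      (((2 * (a / b) : ℝ) : ℂ) • diagConj V Q + R - diagConj U P).PosSemidef ∧
      R.trace.re ≤ (∑ i, if A i then 0 else P i) +
        2 * ∑ i, if B i then 0 else ((Vᴴ * diagConj U P * V) i i).re := by
  set S := diagConj U fun i => if A i then P i else 0 with hS
  set S' := diagConj U fun i => if A i then 0 else P i with hS'
  set W := diagConj V fun i => if B i then 1 else 0 with hW
  set W' := diagConj V fun i => if B i then 0 else 1 with hW'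
  have hSpos : S.PosSemidef := diagConj_posSemidef _ fun i => by split_ifs <;> simp [hP]
  have hSpos' : S'.PosSemidef := diagConj_posSemidef _ fun i => by split_ifs <;> simp [hP]
  have hsum : diagConj U P = S + S' := by
    rw [hS, hS', ← diagConj_add]
    congr 1
    ext i
    by_cases h : A i <;> simp [h]
  have hWsum : W' = 1 - W := by
    rw [eq_sub_iff_add_eq, hW, hW', ← diagConj_add, ← diagConj_one hV']
    congr 1
    ext i
    by_cases h : B i <;> simp [h]
  have hWW : W * W = W := by
    rw [hW, diagConj_mul hV]
    congr 1
    ext i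
    by_cases h : B i <;> simp [h]
  have hWW' : W' * W' = W' := by
    rw [hW', diagConj_mul hV]
    congr 1
    ext i
    by_cases h : B i <;> simp [h]
  have hWh : Wᴴ = W := conjTranspose_diagConj _ _
  have hWh' : W'ᴴ = W' := conjTranspose_diagConj _ _
  have h2 : (0 : ℂ) ≤ 2 := zero_le_two
  have hR2 : (W' * S * W').PosSemidef := by
    have := hSpos.mul_mul_conjTranspose_same W'
    rwa [hWh'] at this
  refine ⟨S' + (2 : ℂ) • (W' * S * W'), hSpos'.add (hR2.smul h2), ?_, ?_⟩
  -- The chain is `S ≤ 2 W S W + 2 W' S W'` (from `t3`), `W S W ≤ a W` (`t2`) and `a W ≤ (a / b) ρ`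
  -- (`t1`). The factor 2 is the price of discarding the off-diagonal blocks of `S`.
  · have t1 : (((a / b : ℝ) : ℂ) • diagConj V Q - (a : ℂ) • W).PosSemidef := by
      have : ((a / b : ℝ) : ℂ) • diagConj V Q - (a : ℂ) • W =
          diagConj V ((a / b) • Q + (-a) • fun i => if B i then 1 else 0) := by
        rw [diagConj_add, diagConj_smul, diagConj_smul, hW]
        push_cast
        rw [neg_smul, sub_eq_add_neg]
      rw [this]
      refine diagConj_posSemidef _ fun i => ?_
      by_cases h : B i
      · have h3 : a / b * b ≤ a / b * Q i :=
          mul_le_mul_of_nonneg_left (hB i h) (div_nonneg ha hb.le)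
        rw [div_mul_cancel₀ _ hb.ne'] at h3
        simpa [h] using h3
      · simpa [h] using mul_nonneg (div_nonneg ha hb.le) (hQ i)
    have t2 : (W * ((a : ℂ) • (1 : Matrix N N ℂ) - S) * W).PosSemidef := by
      have h4 : ((a : ℂ) • (1 : Matrix N N ℂ) - S).PosSemidef := by
        have : (a : ℂ) • (1 : Matrix N N ℂ) - S =
            diagConj U (a • 1 + (-1 : ℝ) • fun i => if A i then P i else 0) := by
          rw [diagConj_add, diagConj_smul, diagConj_smul, diagConj_one hU', hS]
          push_cast
          rw [neg_one_smul, sub_eq_add_neg]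
        rw [this]
        refine diagConj_posSemidef _ fun i => ?_
        by_cases h : A i
        · simpa [h] using hA i h
        · simpa [h] using ha
      have := h4.mul_mul_conjTranspose_same W
      rwa [hWh] at this
    have t3 : ((W - W') * S * (W - W')).PosSemidef := by
      have := hSpos.mul_mul_conjTranspose_same (W - W')
      rwa [Matrix.conjTranspose_sub, hWh, hWh'] at this
    convert ((t1.smul h2).add (t2.smul h2)).add t3 using 1
    have e1 : W * ((a : ℂ) • (1 : Matrix N N ℂ) - S) * W = (a : ℂ) • W - W * S * W := by
      rw [Matrix.mul_sub, Matrix.sub_mul, Matrix.mul_smul, Matrix.smul_mul, Matrix.mul_one, hWW]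
    have e2 : (W - W') * S * (W - W') = (2 : ℂ) • (W * S * W) + (2 : ℂ) • (W' * S * W') - S := by
      rw [hWsum, two_smul, two_smul]
      simp only [Matrix.mul_sub, Matrix.sub_mul, Matrix.mul_one, Matrix.one_mul]
      abel
    rw [e1, e2, hsum, smul_sub, smul_sub, smul_smul]
    push_cast
    abel
  · have hdiff : 0 ≤ (W' * S' * W').trace.re := by
      have := hSpos'.mul_mul_conjTranspose_same W'
      rw [hWh'] at this
      exact this.zero_le_trace_re
    have hfull : (W' * diagConj U P * W').trace.re =
        ∑ i, if B i then 0 else ((Vᴴ * diagConj U P * V) i i).re := by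
      rw [Matrix.trace_mul_comm, ← Matrix.mul_assoc, hWW', Matrix.trace_mul_comm, hW',
        trace_mul_diagConj, Complex.re_sum]
      refine Finset.sum_congr rfl fun i _ => ?_
      by_cases h : B i <;> simp [h]
    rw [Matrix.trace_add, Matrix.trace_smul, Complex.add_re, ← hfull, hsum, Matrix.mul_add,
      Matrix.add_mul, Matrix.trace_add, Complex.add_re]
    have hS'tr : S'.trace.re = ∑ i, if A i then 0 else P i := by
      rw [hS', trace_diagConj hU, Complex.re_sum]
      simp
    have h5 : ((2 : ℂ) • (W' * S * W').trace).re = 2 * (W' * S * W').trace.re := by simp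
    rw [h5, hS'tr]
    linarith

end UnitaryConjugation

lemma tensorPow_diagonal {ι : Type} [DecidableEq ι] (f : ι → ℂ) (n : ℕ) :
    tensorPow (Matrix.diagonal f) n = Matrix.diagonal fun i => ∏ l, f (i l) := by
  ext i j
  simp only [tensorPow, Matrix.of_apply, Matrix.diagonal_apply]
  by_cases h : i = j
  · subst h
    simp
  · obtain ⟨l, hl⟩ := Function.ne_iff.1 h
    rw [if_neg h]
    exact Finset.prod_eq_zero (Finset.mem_univ l) (if_neg hl)

lemma tensorPow_one {ι : Type} [DecidableEq ι] (n : ℕ) : tensorPow (1 : Matrix ι ι ℂ) n = 1 := by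
  rw [← Matrix.diagonal_one, tensorPow_diagonal]
  simp

/-! ### Products of tensor powers and a Chernoff bound -/

section TensorPowerAlgebra

variable {ι : Type} [Fintype ι]

lemma tensorPow_mul (A B : Matrix ι ι ℂ) (n : ℕ) :
    tensorPow (A * B) n = tensorPow A n * tensorPow B n := by
  ext i j
  simp only [tensorPow, Matrix.of_apply, Matrix.mul_apply, ← Finset.prod_mul_distrib]
  rw [Fintype.prod_sum]

lemma tensorPow_diagConj [DecidableEq ι] (U : Matrix ι ι ℂ) (f : ι → ℝ) (n : ℕ) :
    tensorPow (diagConj U f) n = diagConj (tensorPow U n) fun i => ∏ l, f (i l) := by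
  rw [diagConj, tensorPow_mul, tensorPow_mul, tensorPow_diagonal, ← conjTranspose_tensorPow,
    diagConj]
  push_cast
  rfl

/-- Chernoff bound for sums of independent copies of `f` under the weights `w`. -/
lemma exists_chernoff_bound {w f : ι → ℝ} (hw : ∀ i, 0 ≤ w i) (hw1 : ∑ i, w i = 1)
    {δ : ℝ} (hδ : 0 < δ) :
    ∃ c : ℝ, 0 ≤ c ∧ c < 1 ∧ ∀ n : ℕ, (∑ i : Fin n → ι,
      if ∑ l, f (i l) ≤ n * (∑ j, w j * f j + δ) then 0 else ∏ l, w (i l)) ≤ c ^ n := by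
  set μ := ∑ j, w j * f j with hμ
  -- The moment generating function of `f - μ - δ`: since `φ 0 = 1` and `φ' 0 = -δ < 0`, some `s >
  -- 0` has `φ s < 1`, and `c = φ s` works by Markov's inequality.
  set φ : ℝ → ℝ := fun s => ∑ i, w i * Real.exp (s * (f i - (μ + δ))) with hφ
  have hφ0 : φ 0 = 1 := by simp [hφ, hw1]
  have hder : HasDerivAt φ (-δ) 0 := by
    have h1 : HasDerivAt φ (∑ i, w i * (Real.exp (0 * (f i - (μ + δ))) * (1 * (f i - (μ + δ)))))
        0 := by
      refine HasDerivAt.fun_sum fun i _ => ?_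
      exact (((hasDerivAt_id (0 : ℝ)).mul_const (f i - (μ + δ))).exp).const_mul (w i)
    convert h1 using 1
    have h2 : ∀ i, w i * (Real.exp (0 * (f i - (μ + δ))) * (1 * (f i - (μ + δ)))) =
        w i * f i - w i * (μ + δ) := by
      intro i
      rw [zero_mul, Real.exp_zero]
      ring
    simp only [h2, Finset.sum_sub_distrib, ← Finset.sum_mul, hw1, ← hμ]
    ring
  obtain ⟨s, hs, hlt⟩ : ∃ s : ℝ, 0 < s ∧ φ s < 1 := by
    have h2 := (hasDerivAt_iff_tendsto_slope.1 hder).eventually_lt_const (neg_lt_zero.2 hδ)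
    have h3 : ∀ᶠ s in 𝓝[>] (0 : ℝ), slope φ 0 s < 0 :=
      h2.filter_mono (nhdsWithin_mono _ fun x hx => ne_of_gt hx)
    obtain ⟨s, hs1, hs2⟩ := (h3.and self_mem_nhdsWithin).exists
    refine ⟨s, hs2, ?_⟩
    have hs2 : 0 < s := hs2
    rw [slope_def_field, sub_zero, hφ0, div_neg_iff] at hs1
    rcases hs1 with ⟨_, h⟩ | ⟨h, _⟩ <;> linarith
  have hnn : ∀ i, 0 ≤ w i * Real.exp (s * (f i - (μ + δ))) := fun i =>
    mul_nonneg (hw i) (Real.exp_pos _).le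
  refine ⟨φ s, Finset.sum_nonneg fun i _ => hnn i, hlt, fun n => ?_⟩
  have hpow : φ s ^ n = ∑ i : Fin n → ι, ∏ l, (w (i l) * Real.exp (s * (f (i l) - (μ + δ)))) := by
    rw [← Fintype.prod_sum fun (_ : Fin n) i => w i * Real.exp (s * (f i - (μ + δ)))]
    simp [hφ]
  rw [hpow]
  refine Finset.sum_le_sum fun i _ => ?_
  split_ifs with h
  · exact Finset.prod_nonneg fun l _ => hnn _
  · rw [Finset.prod_mul_distrib, ← Real.exp_sum]
    refine le_mul_of_one_le_right (Finset.prod_nonneg fun l _ => hw _) ?_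
    rw [Real.one_le_exp_iff, ← Finset.mul_sum, Finset.sum_sub_distrib]
    refine mul_nonneg hs.le ?_
    simp only [Finset.sum_const, Finset.card_univ, Fintype.card_fin, nsmul_eq_mul]
    linarith

end TensorPowerAlgebra

/-! ### Relative entropy as the exponent of domination -/

section RelativeEntropy

variable {d : ℕ} {ρ σ : Matrix (Fin d) (Fin d) ℂ}

/-- A density matrix is diagonalized by a unitary, and its logarithm accordingly. -/
lemma IsState.exists_diagConj (hρ : IsState ρ) : ∃ (U : Matrix (Fin d) (Fin d) ℂ) (p : Fin d → ℝ),
    Uᴴ * U = 1 ∧ U * Uᴴ = 1 ∧ (∀ i, 0 ≤ p i) ∧ ∑ i, p i = 1 ∧ ρ = diagConj U p ∧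
      cfc Real.log ρ = diagConj U fun i => Real.log (p i) := by
  have hH := hρ.posSemidef.isHermitian
  have h1 : (hH.eigenvectorUnitary : Matrix (Fin d) (Fin d) ℂ)ᴴ * hH.eigenvectorUnitary = 1 :=
    Unitary.coe_star_mul_self hH.eigenvectorUnitary
  have hs : ρ = diagConj hH.eigenvectorUnitary hH.eigenvalues := hH.spectral_theorem
  refine ⟨hH.eigenvectorUnitary, hH.eigenvalues, h1,
    Unitary.coe_mul_star_self hH.eigenvectorUnitary, hρ.posSemidef.eigenvalues_nonneg, ?_, hs, ?_⟩
  · have h2 := hρ.trace_eq_one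
    rw [hs, trace_diagConj h1] at h2
    exact_mod_cast h2
  · rw [hH.cfc_eq]
    rfl

/-- `σ^{⊗n} ≤ 2 exp (n (D(σ‖ρ) + ε)) ρ^{⊗n}` up to a remainder of exponentially small trace. -/
lemma exists_tensorPow_bound (hρ : IsState ρ) (hσ : IsState σ) (hD : relEntropy σ ρ < ⊤)
    {ε : ℝ} (hε : 0 < ε) :
    ∃ c : ℝ, 0 ≤ c ∧ c < 1 ∧ ∀ n : ℕ, ∃ R : Matrix (Fin n → Fin d) (Fin n → Fin d) ℂ,
      R.PosSemidef ∧
      (((2 * Real.exp (n * ((relEntropy σ ρ).toReal + ε)) : ℝ) : ℂ) • tensorPow ρ n + R -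
        tensorPow σ n).PosSemidef ∧ R.trace.re ≤ 3 * c ^ n := by
  classical
  have hsupp : ∀ v : Fin d → ℂ, ρ *ᵥ v = 0 → σ *ᵥ v = 0 := by
    by_contra h
    simp [relEntropy, h] at hD
  obtain ⟨U, p, hU, hU', hp, hp1, hσU, hlogσ⟩ := hσ.exists_diagConj
  obtain ⟨V, q, hV, hV', hq, -, hρV, hlogρ⟩ := hρ.exists_diagConj
  -- `r` is the distribution of `σ` measured in the eigenbasis of `ρ`. Then `D(σ‖ρ) = ∑ p log p - ∑
  -- r log q`, and each term gets its own law of large numbers.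
  set r : Fin d → ℝ := fun j => ((Vᴴ * σ * V) j j).re with hr
  have hpsd : (Vᴴ * σ * V).PosSemidef := hσ.posSemidef.conjTranspose_mul_mul_same V
  have hrc : ∀ j, ((r j : ℝ) : ℂ) = (Vᴴ * σ * V) j j := fun j =>
    (Complex.eq_re_of_ofReal_le (r := 0) (by simpa using hpsd.diag_nonneg (i := j))).symm
  have hr0 : ∀ j, 0 ≤ r j := fun j => (Complex.nonneg_iff.1 (hpsd.diag_nonneg (i := j))).1
  have hr1 : ∑ j, r j = 1 := by
    have : (Vᴴ * σ * V).trace = 1 := by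
      rw [Matrix.mul_assoc, Matrix.trace_mul_comm, Matrix.mul_assoc, hV', Matrix.mul_one,
        hσ.trace_eq_one]
    rw [Matrix.trace] at this
    simp only [Matrix.diag_apply, ← hrc] at this
    exact_mod_cast this
  -- The support condition enters here: a kernel eigenvector of `ρ` carries no weight of `σ`.
  have hrq : ∀ j, q j = 0 → r j = 0 := by
    intro j hj
    have hv : ρ *ᵥ (fun k => V k j) = 0 := by
      have h1 : ρ * V = V * Matrix.diagonal fun i => (q i : ℂ) := by
        rw [hρV, diagConj, Matrix.mul_assoc, hV, Matrix.mul_one]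
      ext k
      have h2 := congrFun (congrFun h1 k) j
      rw [Matrix.mul_diagonal, hj] at h2
      simpa [Matrix.mul_apply, Matrix.mulVec, dotProduct] using h2
    have h3 := hsupp _ hv
    have h4 : (Vᴴ * σ * V) j j = ∑ k, Vᴴ j k * (σ *ᵥ fun k => V k j) k := by
      rw [Matrix.mul_assoc]
      simp [Matrix.mul_apply, Matrix.mulVec, dotProduct]
    simp [hr, h4, h3]
  have hDval : (relEntropy σ ρ).toReal =
      ∑ i, p i * Real.log (p i) - ∑ j, r j * Real.log (q j) := by
    rw [relEntropy, if_pos hsupp, EReal.toReal_coe, Matrix.mul_sub, Matrix.trace_sub,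
      Complex.sub_re, hlogσ, hlogρ, trace_mul_diagConj, trace_mul_diagConj]
    congr 1
    · rw [hσU, conj_diagConj hU, Complex.re_sum]
      refine Finset.sum_congr rfl fun i _ => ?_
      rw [Matrix.diagonal_apply_eq, ← Complex.ofReal_mul, Complex.ofReal_re, mul_comm]
    · rw [Complex.re_sum]
      refine Finset.sum_congr rfl fun i _ => ?_
      rw [← hrc, ← Complex.ofReal_mul, Complex.ofReal_re, mul_comm]
  obtain ⟨c₁, hc₁, hc₁', hch₁⟩ :=
    exists_chernoff_bound (f := fun i => Real.log (p i)) hp hp1 (half_pos hε)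
  obtain ⟨c₂, hc₂, hc₂', hch₂⟩ :=
    exists_chernoff_bound (f := fun i => -Real.log (q i)) hr0 hr1 (half_pos hε)
  refine ⟨max c₁ c₂, le_max_of_le_left hc₁, max_lt hc₁' hc₂', fun n => ?_⟩
  have hexp : ∀ (f : Fin d → ℝ) (i : Fin n → Fin d), (∀ l, 0 < f (i l)) →
      ∏ l, f (i l) = Real.exp (∑ l, Real.log (f (i l))) := by
    intro f i hf
    rw [Real.exp_sum]
    exact Finset.prod_congr rfl fun l _ => (Real.exp_log (hf l)).symm
  obtain ⟨R, hR, hRle, hRtr⟩ := exists_remainder_of_typical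
    (U := tensorPow U n) (V := tensorPow V n)
    (by rw [conjTranspose_tensorPow, ← tensorPow_mul, hU, tensorPow_one])
    (by rw [conjTranspose_tensorPow, ← tensorPow_mul, hU', tensorPow_one])
    (by rw [conjTranspose_tensorPow, ← tensorPow_mul, hV, tensorPow_one])
    (by rw [conjTranspose_tensorPow, ← tensorPow_mul, hV', tensorPow_one])
    (P := fun i => ∏ l, p (i l)) (Q := fun i => ∏ l, q (i l))
    (fun i => Finset.prod_nonneg fun l _ => hp _) (fun i => Finset.prod_nonneg fun l _ => hq _)
    (fun i => ∑ l, Real.log (p (i l)) ≤ n * (∑ j, p j * Real.log (p j) + ε / 2))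
    -- Positivity is required separately because `log 0 = 0` would let indices with a zero
    -- eigenvalue pass. By `hrq` these have no weight under `r`.
    (fun i => (∑ l, -Real.log (q (i l)) ≤ n * (∑ j, r j * -Real.log (q j) + ε / 2)) ∧
      ∀ l, 0 < q (i l))
    (a := Real.exp (n * (∑ j, p j * Real.log (p j) + ε / 2)))
    (b := Real.exp (-(n * (∑ j, r j * -Real.log (q j) + ε / 2))))
    (Real.exp_pos _).le (Real.exp_pos _)
    (by
      intro i hi
      by_cases h : ∀ l, 0 < p (i l)
      · rw [hexp p i h]
        exact Real.exp_le_exp.2 hi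
      · push Not at h
        obtain ⟨l, hl⟩ := h
        rw [Finset.prod_eq_zero (Finset.mem_univ l) (le_antisymm hl (hp _))]
        exact (Real.exp_pos _).le)
    (by
      rintro i ⟨hi, h⟩
      rw [hexp q i h]
      refine Real.exp_le_exp.2 ?_
      rw [Finset.sum_neg_distrib] at hi
      linarith)
  refine ⟨R, hR, ?_, ?_⟩
  · rw [← tensorPow_diagConj, ← tensorPow_diagConj, ← hσU, ← hρV, ← Real.exp_sub] at hRle
    convert hRle using 6
    rw [hDval]
    simp only [mul_neg, Finset.sum_neg_distrib]
    ring_nf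
  · refine hRtr.trans ?_
    have h1 : (∑ i : Fin n → Fin d, if ∑ l, Real.log (p (i l)) ≤
        n * (∑ j, p j * Real.log (p j) + ε / 2) then 0 else ∏ l, p (i l)) ≤ (max c₁ c₂) ^ n :=
      (hch₁ n).trans (pow_le_pow_left₀ hc₁ (le_max_left _ _) n)
    have h2 : (∑ i : Fin n → Fin d, if ∑ l, -Real.log (q (i l)) ≤
        n * (∑ j, r j * -Real.log (q j) + ε / 2) then 0 else ∏ l, r (i l)) ≤ (max c₁ c₂) ^ n :=
      (hch₂ n).trans (pow_le_pow_left₀ hc₂ (le_max_right _ _) n)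
    have h3 : ∀ i : Fin n → Fin d, (((tensorPow V n)ᴴ *
        diagConj (tensorPow U n) (fun i => ∏ l, p (i l)) * tensorPow V n) i i).re =
          ∏ l, r (i l) := by
      intro i
      rw [← tensorPow_diagConj, conjTranspose_tensorPow, ← hσU, ← tensorPow_mul, ← tensorPow_mul]
      simp only [tensorPow, Matrix.of_apply, ← hrc]
      rw [← Complex.ofReal_prod, Complex.ofReal_re]
    simp only [h3]
    refine le_trans (add_le_add h1 (mul_le_mul_of_nonneg_left (le_trans ?_ h2) zero_le_two))
      (le_of_eq (by ring))
    refine Finset.sum_le_sum fun i _ => ?_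
    by_cases hq0 : ∀ l, 0 < q (i l)
    · simp [hq0]
    · have : ∏ l, r (i l) = 0 := by
        push Not at hq0
        obtain ⟨l, hl⟩ := hq0
        exact Finset.prod_eq_zero (Finset.mem_univ l) (hrq _ (le_antisymm hl (hq _)))
      simp [this]

/-- If `D` were negative, taking traces in the tensor power bound with slack `-D / 2` would give `1
≤ 2 exp (n D / 2) + 3 c ^ n`, whose right side tends to zero. -/
lemma relEntropy_toReal_nonneg (hρ : IsState ρ) (hσ : IsState σ) (hD : relEntropy σ ρ < ⊤) :
    0 ≤ (relEntropy σ ρ).toReal := by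
  by_contra! hneg
  set D := (relEntropy σ ρ).toReal
  obtain ⟨c, hc0, hc1, hc⟩ := exists_tensorPow_bound hρ hσ hD (ε := -D / 2) (by linarith)
  have htr : ∀ {A : Matrix (Fin d) (Fin d) ℂ}, IsState A → ∀ n, (tensorPow A n).trace = 1 := by
    intro A hA n
    simp only [Matrix.trace, Matrix.diag_apply, tensorPow, Matrix.of_apply]
    rw [← Fintype.prod_sum fun (_ : Fin n) i => A i i]
    have : ∑ i, A i i = 1 := hA.trace_eq_one
    simp [this]
  have hle : ∀ n : ℕ, 1 ≤ 2 * Real.exp (D / 2) ^ n + 3 * c ^ n := by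
    intro n
    obtain ⟨R, hR, hRle, hRtr⟩ := hc n
    have h := hRle.zero_le_trace_re
    rw [Matrix.trace_sub, Matrix.trace_add, Matrix.trace_smul, htr hρ, htr hσ, smul_eq_mul, mul_one,
      Complex.sub_re, Complex.add_re, Complex.ofReal_re, Complex.one_re] at h
    rw [← Real.exp_nat_mul]
    have : (n : ℝ) * (D + -D / 2) = n * (D / 2) := by ring
    rw [this] at h
    linarith
  have h1 : Real.exp (D / 2) < 1 := Real.exp_lt_one_iff.2 (by linarith)
  have hlim := ((tendsto_pow_atTop_nhds_zero_of_lt_one (Real.exp_pos (D / 2)).le h1).const_mul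
    2).add ((tendsto_pow_atTop_nhds_zero_of_lt_one hc0 hc1).const_mul 3)
  have := ge_of_tendsto' hlim hle
  norm_num at this

end RelativeEntropy

/-! ### Change of measure on a window after the change -/

namespace Strategy

variable {d : ℕ} {X : Type} {s : Strategy d X} {ρ σ : Matrix (Fin d) (Fin d) ℂ}

lemma recordProb_top (σ' : Matrix (Fin d) (Fin d) ℂ) (h : List X) :
    s.recordProb ρ σ ⊤ h = s.recordProb ρ σ' ⊤ h := by
  unfold recordProb
  rw [memState_top σ']

lemma recordProb_eq_top (h : List X) :
    s.recordProb ρ σ h.length h = s.recordProb ρ σ ⊤ h := by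
  unfold recordProb
  rw [memState_eq_top _ _ le_rfl]

lemma recSum_recordProb_append (hρ : IsState ρ) (hσ : IsState σ) (ν : ℕ∞) (m : ℕ) (h : List X) :
    recSum m (fun g => s.recordProb ρ σ ν (g ++ h)) = s.recordProb ρ σ ν h := by
  induction m with
  | zero => simp [recSum_zero]
  | succ m ih =>
    rw [recSum_succ, ← ih]
    exact recSum_congr fun g _ => tsum_recordProb_cons hρ hσ ν (g ++ h)

lemma Silent.of_append {g h : List X} (H : s.Silent (g ++ h)) : s.Silent h := by
  induction g with
  | nil => exact H
  | cons x g ih => exact ih H.1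

/-- The records of which the last `m` outcomes contain the first alarm. -/
def alarmWithin (s : Strategy d X) (m : ℕ) : Set (List X) :=
  {h | s.Silent (h.drop m) ∧ ¬ s.Silent h}

lemma probGT_nil_eq_add (hρ : IsState ρ) (hσ : IsState σ) (ν : ℕ∞) (k m : ℕ) :
    s.probGT ρ σ ν k [] =
      s.prob ρ σ ν (k + m) (s.alarmWithin m) + s.probGT ρ σ ν (k + m) [] := by
  classical
  unfold probGT alarmWithin
  simp only [prob_eq, Set.mem_ofPred_eq, List.nil_suffix, and_true]
  rw [← recSum_add_fun, recSum_add]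
  refine recSum_congr fun h _ => ?_
  rw [← recSum_recordProb_append hρ hσ ν m h]
  have : ∀ (p : Prop) [Decidable p] (c : ℝ≥0∞), (if p then c else 0) = (if p then 1 else 0) * c := by
    intro p _ c
    split_ifs <;> simp
  rw [this, ← recSum_const_mul]
  refine recSum_congr fun g hg => ?_
  subst hg
  by_cases h1 : s.Silent (g ++ h)
  · simp [h1, h1.of_append]
  · simp [h1]

/-- Change of measure: an alarm within `m` steps of the change is not much more likely than a false
alarm within these steps. -/
lemma prob_alarmWithin_le (hρ : IsState ρ) (hσ : IsState σ) {K : ℕ → ℝ} (hK : ∀ n, 0 ≤ K n)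
    {R : (n : ℕ) → Matrix (Fin n → Fin d) (Fin n → Fin d) ℂ} (hR : ∀ n, (R n).PosSemidef)
    (hle : ∀ n, ((K n : ℂ) • tensorPow ρ n + R n - tensorPow σ n).PosSemidef) (ν m : ℕ) :
    s.prob ρ σ ν (ν + m) (s.alarmWithin m) ≤
      ENNReal.ofReal (K m) * s.prob ρ σ ⊤ (ν + m) (s.alarmWithin m) +
        ENNReal.ofReal (R m).trace.re * s.probGT ρ σ ⊤ ν [] := by
  classical
  unfold probGT alarmWithin
  simp only [prob_eq, Set.mem_ofPred_eq, List.nil_suffix, and_true]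
  rw [recSum_add, recSum_add, ← recSum_const_mul, ← recSum_const_mul, ← recSum_add_fun]
  refine recSum_mono fun h hh => ?_
  rw [← recSum_const_mul]
  by_cases hs : s.Silent h
  · have hτ : (s.memState ρ σ ⊤ h).PosSemidef := memState_posSemidef hρ hσ _ _
    -- The remainder term is expanded over all continuations `g`, so that the comparison can be made
    -- record by record.
    rw [if_pos hs, recordProb, ← recSum_trace_evolve hτ m R hR, ← recSum_add_fun]
    refine recSum_mono fun g hg => ?_
    subst hg
    by_cases hg : s.Silent (g ++ h)
    · simp [hg]
    · have hdrop : s.Silent ((g ++ h).drop g.length) ∧ ¬ s.Silent (g ++ h) := by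
        rw [List.drop_left]
        exact ⟨hs, hg⟩
      rw [if_pos hdrop, if_pos hdrop]
      have h1 := (evolve_posSemidef hτ g (hle g.length)).zero_le_trace_re
      have h2 : s.evolve h (s.memState ρ σ ⊤ h) g (tensorPow σ g.length) =
          s.memState ρ σ ν (g ++ h) := by
        rw [← hh, ← evolve_tensorPow, memState_eq_top _ _ le_rfl]
      rw [map_sub, map_add, map_smul, evolve_tensorPow_top, h2, Matrix.trace_sub, Matrix.trace_add,
        Matrix.trace_smul, smul_eq_mul, Complex.sub_re, Complex.add_re, Complex.re_ofReal_mul,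
        sub_nonneg] at h1
      unfold recordProb
      rw [← ENNReal.ofReal_mul (hK _), ← ENNReal.ofReal_add]
      · exact ENNReal.ofReal_le_ofReal h1
      · exact mul_nonneg (hK _) (memState_posSemidef hρ hσ _ _).zero_le_trace_re
      · exact (evolve_posSemidef hτ g (hR _)).zero_le_trace_re
  · refine le_trans (recSum_mono (g := fun _ => 0) fun g hg => ?_) (by simp [recSum])
    subst hg
    simp [hs]

end Strategy

/-- If in every window of `m` steps the fraction `q` of the mass of `a` is lost, then the total mass
is at most `m / q`. -/
lemma mul_tsum_le_of_window {a : ℕ → ℝ≥0∞} (ha : ∀ n, a n ≤ 1) {q : ℝ≥0∞} {m : ℕ}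
    (h : ∀ n, q * a n + a (n + m) ≤ a n) : q * ∑' n, a n ≤ m := by
  rw [← ENNReal.tsum_mul_left, ENNReal.tsum_eq_iSup_nat]
  refine iSup_le fun N => ?_
  -- The shifted partial sum is added to both sides and must be finite to be cancelled. What remains
  -- is bounded by the first `m` terms of `a`, each at most 1.
  have hfin : ∑ n ∈ Finset.range N, a (n + m) ≠ ⊤ :=
    ENNReal.sum_ne_top.2 fun n _ => ne_top_of_le_ne_top ENNReal.one_ne_top (ha _)
  rw [← ENNReal.add_le_add_iff_right hfin, ← Finset.sum_add_distrib]
  calc ∑ n ∈ Finset.range N, (q * a n + a (n + m))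
      ≤ ∑ n ∈ Finset.range N, a n := Finset.sum_le_sum fun n _ => h n
    _ ≤ ∑ n ∈ Finset.range (m + N), a n :=
        Finset.sum_le_sum_of_subset (Finset.range_mono (by omega))
    _ = ∑ n ∈ Finset.range m, a n + ∑ n ∈ Finset.range N, a (n + m) := by
        rw [Finset.sum_range_add]
        simp only [add_comm]
    _ ≤ m + ∑ n ∈ Finset.range N, a (n + m) := by
        gcongr
        exact (Finset.sum_le_sum fun n _ => ha n).trans (by simp)

/-! ### From an unlikely false alarm to a lower bound on the delay -/

namespace Strategy

variable {d : ℕ} {X : Type} {s : Strategy d X} {ρ σ : Matrix (Fin d) (Fin d) ℂ}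

lemma falseAlarmTime_eq (hρ : IsState ρ) (σ : Matrix (Fin d) (Fin d) ℂ) :
    s.falseAlarmTime ρ = ∑' n, s.probGT ρ σ ⊤ n [] := by
  unfold falseAlarmTime
  rw [expExcess_eq_tsum hρ hρ _ _ _ (by simp)]
  refine tsum_congr fun n => ?_
  rw [zero_add]
  unfold probGT prob
  simp only [recordProb_top σ]

lemma probGT_self (ν : ℕ) : s.probGT ρ σ ν ν [] = s.probGT ρ σ ⊤ ν [] := by
  classical
  unfold probGT
  simp only [prob_eq]
  refine recSum_congr fun h hh => ?_
  rw [← recordProb_eq_top, hh]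

/-- Some time `ν` is such that a false alarm in the `m` steps after `ν` is unlikely. -/
lemma exists_unlikely_alarmWithin (hρ : IsState ρ) (hσ : IsState σ) {m : ℕ} {q : ℝ≥0∞}
    (hq : m < q * s.falseAlarmTime ρ) :
    ∃ ν : ℕ, 0 < s.probGT ρ σ ⊤ ν [] ∧
      s.prob ρ σ ⊤ (ν + m) (s.alarmWithin m) ≤ q * s.probGT ρ σ ⊤ ν [] := by
  by_contra! hc
  refine absurd hq (not_lt.2 ?_)
  rw [falseAlarmTime_eq hρ σ]
  refine mul_tsum_le_of_window (a := fun n => s.probGT ρ σ ⊤ n [])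
    (fun n => prob_le_one hρ hσ _ _ _) fun n => ?_
  rcases eq_or_ne (s.probGT ρ σ ⊤ n []) 0 with h0 | h0
  · have := probGT_nil_eq_add (s := s) hρ hσ ⊤ n m
    rw [h0, eq_comm, add_eq_zero] at this
    rw [h0, this.2]
    simp
  · conv_rhs => rw [probGT_nil_eq_add hρ hσ ⊤ n m]
    gcongr
    exact (hc n (pos_iff_ne_zero.2 h0)).le

lemma mul_probGT_le_expExcess (hρ : IsState ρ) (hσ : IsState σ) (ν m : ℕ) :
    m * s.probGT ρ σ ν (ν + m) [] ≤ s.expExcess ρ σ ν ν [] := by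
  rw [expExcess_eq_tsum hρ hσ _ _ _ (by simp)]
  refine le_trans ?_ (ENNReal.sum_le_tsum (Finset.range m))
  calc (m : ℝ≥0∞) * s.probGT ρ σ ν (ν + m) []
      = ∑ n ∈ Finset.range m, s.probGT ρ σ ν (ν + m) [] := by simp
    _ ≤ _ := Finset.sum_le_sum fun n hn =>
        probGT_antitone hρ hσ ν ν [] (by simp) (Finset.mem_range.1 hn).le

/-- Given `T > ν`, either the alarm comes within `m` steps, which has conditional probability at
most `η`, or the delay exceeds `m`. The additive form avoids truncated subtraction. -/
lemma le_meanDelay_of_unlikely (hρ : IsState ρ) (hσ : IsState σ) {ν m : ℕ} {η : ℝ≥0∞}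
    (hpos : 0 < s.probGT ρ σ ν ν [])
    (h : s.prob ρ σ ν (ν + m) (s.alarmWithin m) ≤ η * s.probGT ρ σ ν ν []) :
    m ≤ s.meanDelay ρ σ + m * η := by
  have hfin : s.probGT ρ σ ν ν [] ≠ ⊤ :=
    ne_top_of_le_ne_top ENNReal.one_ne_top (prob_le_one hρ hσ _ _ _)
  have h1 : s.expExcess ρ σ ν ν [] ≤ s.meanDelay ρ σ * s.probGT ρ σ ν ν [] := by
    rw [← ENNReal.div_le_iff hpos.ne' hfin]
    exact le_iSup₂ (f := fun (ν : ℕ) (_ : 0 < s.probGT ρ σ ν ν []) =>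
      s.expExcess ρ σ ν ν [] / s.probGT ρ σ ν ν []) ν hpos
  rw [← ENNReal.mul_le_mul_iff_left hpos.ne' hfin]
  calc (m : ℝ≥0∞) * s.probGT ρ σ ν ν []
      = m * s.prob ρ σ ν (ν + m) (s.alarmWithin m) + m * s.probGT ρ σ ν (ν + m) [] := by
        rw [← mul_add, ← probGT_nil_eq_add hρ hσ]
    _ ≤ m * (η * s.probGT ρ σ ν ν []) + s.meanDelay ρ σ * s.probGT ρ σ ν ν [] := by
        exact add_le_add (mul_le_mul_right h _) ((mul_probGT_le_expExcess hρ hσ ν m).trans h1)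
    _ = (s.meanDelay ρ σ + m * η) * s.probGT ρ σ ν ν [] := by ring

lemma ofReal_le_meanDelay (hρ : IsState ρ) (hσ : IsState σ) {ε c : ℝ} (hc : 0 ≤ c)
    (hbound : ∀ n : ℕ, ∃ R : Matrix (Fin n → Fin d) (Fin n → Fin d) ℂ, R.PosSemidef ∧
      (((2 * Real.exp (n * ((relEntropy σ ρ).toReal + ε)) : ℝ) : ℂ) • tensorPow ρ n + R -
        tensorPow σ n).PosSemidef ∧ R.trace.re ≤ 3 * c ^ n)
    {t : ℝ} (ht : 0 < t) (hT : ENNReal.ofReal t ≤ s.falseAlarmTime ρ) (m : ℕ) :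
    ENNReal.ofReal (m * (1 - (2 * Real.exp (m * ((relEntropy σ ρ).toReal + ε)) * (2 * m / t) +
      3 * c ^ m))) ≤ s.meanDelay ρ σ := by
  rcases Nat.eq_zero_or_pos m with rfl | hm
  · simp
  have hm' : (0 : ℝ) < m := Nat.cast_pos.2 hm
  choose R hR hle htr using hbound
  obtain ⟨ν, hν, hprob⟩ := exists_unlikely_alarmWithin (s := s) (m := m)
    -- The choice `m / t` would give only equality when `E_∞[T] = t`; the factor 2 makes the
    -- inequality strict.
    (q := ENNReal.ofReal (2 * m / t)) hρ hσ (by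
      refine lt_of_lt_of_le ?_ (mul_le_mul_right hT _)
      rw [← ENNReal.ofReal_mul (by positivity), div_mul_cancel₀ _ ht.ne', ← ENNReal.ofReal_natCast,
        ENNReal.ofReal_lt_ofReal_iff (by positivity)]
      linarith)
  set K : ℕ → ℝ := fun n => 2 * Real.exp (n * ((relEntropy σ ρ).toReal + ε)) with hK
  have hK0 : ∀ n, 0 ≤ K n := fun n => by positivity
  set η : ℝ := K m * (2 * m / t) + 3 * c ^ m with hη
  have hKq : 0 ≤ K m * (2 * m / t) := mul_nonneg (hK0 m) (by positivity)
  have hcm : 0 ≤ 3 * c ^ m := by positivity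
  have halarm : s.prob ρ σ ν (ν + m) (s.alarmWithin m) ≤
      ENNReal.ofReal η * s.probGT ρ σ ν ν [] := by
    refine (prob_alarmWithin_le hρ hσ hK0 hR hle ν m).trans ?_
    rw [probGT_self, hη, ENNReal.ofReal_add hKq hcm, ENNReal.ofReal_mul (hK0 m), add_mul, mul_assoc]
    gcongr
    exact htr m
  have h1 := le_meanDelay_of_unlikely hρ hσ (by rwa [probGT_self]) halarm
  have h2 : (m : ℝ) * (1 - η) = m - m * η := by ring
  rw [h2, ENNReal.ofReal_sub _ (by positivity), ENNReal.ofReal_mul (by positivity),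
    ENNReal.ofReal_natCast]
  exact tsub_le_iff_right.2 h1

end Strategy

/-! ### Asymptotics and the final bound -/

/-- The relative error of the delay bound vanishes. -/
lemma tendsto_floor_mul_div {κ C c : ℝ} (hκ : 0 < κ) (hc0 : 0 ≤ c) (hc1 : c < 1)
    {η : ℝ → ℝ} (hη0 : ∀ x, 0 ≤ η x)
    (hη : ∀ x, 0 ≤ x → η x ≤ C * (x * Real.exp (-(κ * x))) + 3 * c ^ ⌊x⌋₊) :
    Filter.Tendsto (fun x : ℝ => ⌊x⌋₊ * (1 - η x) / x - 1) Filter.atTop (𝓝 0) := by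
  have h1 : Filter.Tendsto (fun x : ℝ => C * (x * Real.exp (-(κ * x))) + 3 * c ^ ⌊x⌋₊)
      Filter.atTop (𝓝 (C * 0 + 3 * 0)) := by
    refine Filter.Tendsto.add ?_ ?_
    · refine Filter.Tendsto.const_mul C ?_
      have h := ((Real.tendsto_pow_mul_exp_neg_atTop_nhds_zero 1).comp
        (Filter.tendsto_id.const_mul_atTop hκ)).const_mul κ⁻¹
      rw [mul_zero] at h
      refine h.congr fun x => ?_
      simp only [Function.comp, pow_one, id]
      field_simp
    · exact ((tendsto_pow_atTop_nhds_zero_of_lt_one hc0 hc1).comp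
        tendsto_nat_floor_atTop).const_mul 3
  have h2 : Filter.Tendsto η Filter.atTop (𝓝 0) := by
    refine squeeze_zero' (Filter.Eventually.of_forall hη0) ?_ (by simpa using h1)
    filter_upwards [Filter.eventually_ge_atTop 0] with x hx using hη x hx
  have h3 := ((tendsto_nat_floor_div_atTop (R := ℝ)).mul (h2.const_sub 1)).sub_const 1
  simp only [sub_zero, mul_one, sub_self] at h3
  refine h3.congr fun x => ?_
  ring

open Strategy in
lemma exists_delay_bound {d : ℕ} {ρ σ : Matrix (Fin d) (Fin d) ℂ} (hρ : IsState ρ)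
    (hσ : IsState σ) (hD : relEntropy σ ρ < ⊤) {ε : ℝ} (hε : 0 < ε) :
    ∃ δ : ℝ → ℝ, Filter.Tendsto δ Filter.atTop (𝓝 0) ∧
      ∀ (X : Type) (s : Strategy d X) (t : ℝ), 1 ≤ t → ENNReal.ofReal t ≤ s.falseAlarmTime ρ →
        ENNReal.ofReal ((1 - ε) * (Real.log t / (relEntropy σ ρ).toReal) * (1 + δ t)) ≤
          s.meanDelay ρ σ := by
  have hD0 := relEntropy_toReal_nonneg hρ hσ hD
  -- Otherwise the bound is trivial: its prefactor is nonpositive if `1 ≤ ε`, and division by zero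
  -- yields zero if `D = 0`.
  by_cases hcase : ε < 1 ∧ 0 < (relEntropy σ ρ).toReal
  swap
  · refine ⟨fun _ => 0, tendsto_const_nhds, fun X s t ht _ => ?_⟩
    rw [ENNReal.ofReal_of_nonpos]
    · exact zero_le
    rw [add_zero, mul_one]
    rcases hD0.eq_or_lt with h | h
    · simp [← h]
    · have h1 : 1 ≤ ε := not_lt.1 fun h1 => hcase ⟨h1, h⟩
      exact mul_nonpos_of_nonpos_of_nonneg (by linarith) (div_nonneg (Real.log_nonneg ht) hD0)
  obtain ⟨hε1, hDpos⟩ := hcase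
  set D := (relEntropy σ ρ).toReal with hDdef
  obtain ⟨c, hc0, hc1, hc⟩ := exists_tensorPow_bound hρ hσ hD (ε := ε * D) (mul_pos hε hDpos)
  have h1ε : 0 < 1 - ε := by linarith
  -- in terms of `x = (1 - ε) log t / D`, that is, `t = exp (D x / (1 - ε))`
  set η : ℝ → ℝ := fun x => 2 * Real.exp (⌊x⌋₊ * (D + ε * D)) *
    (2 * ⌊x⌋₊ / Real.exp (D / (1 - ε) * x)) + 3 * c ^ ⌊x⌋₊ with hη
  -- The rate at which `t` outgrows `K`: the slack `ε D` is affordable because `1 / (1 - ε) > 1 +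
  -- ε`.
  have hκ : 0 < D / (1 - ε) - (D + ε * D) := by
    have : D / (1 - ε) - (D + ε * D) = D * ε ^ 2 / (1 - ε) := by
      field_simp
      ring
    rw [this]
    positivity
  have hlim := tendsto_floor_mul_div (η := η) (C := 4) hκ hc0 hc1 (fun x => by positivity) (by
    intro x hx
    have hfl : (⌊x⌋₊ : ℝ) ≤ x := Nat.floor_le hx
    simp only [hη]
    refine add_le_add_left ?_ _
    have e1 : Real.exp (⌊x⌋₊ * (D + ε * D)) ≤ Real.exp (x * (D + ε * D)) := by
      gcongr
    calc 2 * Real.exp (⌊x⌋₊ * (D + ε * D)) * (2 * ⌊x⌋₊ / Real.exp (D / (1 - ε) * x))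
        ≤ 2 * Real.exp (x * (D + ε * D)) * (2 * x / Real.exp (D / (1 - ε) * x)) := by gcongr
      _ = 4 * (x * (Real.exp (x * (D + ε * D)) / Real.exp (D / (1 - ε) * x))) := by ring
      _ = 4 * (x * Real.exp (-((D / (1 - ε) - (D + ε * D)) * x))) := by
          rw [← Real.exp_sub]
          ring_nf)
  have hL : Filter.Tendsto (fun t : ℝ => (1 - ε) * (Real.log t / D)) Filter.atTop Filter.atTop :=
    (Real.tendsto_log_atTop.atTop_div_const hDpos).const_mul_atTop h1ε
  -- Here `δ` is defined so that `x (1 + δ)` is exactly the bound `⌊x⌋ (1 - η x)` obtained with `m =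
  -- ⌊x⌋`, as long as `x ≠ 0`.
  refine ⟨_, hlim.comp hL, fun X s t ht hT => ?_⟩
  have ht0 : 0 < t := by linarith
  set x := (1 - ε) * (Real.log t / D) with hx
  have htx : Real.exp (D / (1 - ε) * x) = t := by
    have : D / (1 - ε) * x = Real.log t := by
      rw [hx]
      field_simp
    rw [this, Real.exp_log ht0]
  rcases eq_or_ne x 0 with h0 | h0
  · simp [h0]
  · have := ofReal_le_meanDelay hρ hσ hc0 hc ht0 hT ⌊x⌋₊
    convert this using 2
    simp only [Function.comp, ← hx, hη, htx, ← hDdef]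
    field_simp
    ring

end QuantumChangePoint

open QuantumChangePoint in
theorem theorem2 {d : ℕ} (ρ : Matrix (Fin d) (Fin d) ℂ) (hρ : IsState ρ) :
    -- one post-change state
    (∀ σ : Matrix (Fin d) (Fin d) ℂ, IsState σ → σ ≠ ρ → relEntropy σ ρ < ⊤ →
      ∀ ε : ℝ, 0 < ε → ∃ δ : ℝ → ℝ, Filter.Tendsto δ Filter.atTop (𝓝 0) ∧
        ∀ (X : Type) [Countable X] (s : Strategy d X) (t : ℝ), 1 ≤ t →
          ENNReal.ofReal t ≤ s.falseAlarmTime ρ →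
          s.meanDelay ρ σ ≤ s.worstMeanDelay ρ σ ∧
          ENNReal.ofReal ((1 - ε) * (Real.log t / (relEntropy σ ρ).toReal) * (1 + δ t)) ≤
            s.meanDelay ρ σ) ∧
    -- a finite family of possible post-change states, unknown to the strategy
    (∀ (S : Finset (Matrix (Fin d) (Fin d) ℂ)) (hS : S.Nonempty),
      (∀ σ ∈ S, IsState σ ∧ σ ≠ ρ ∧ relEntropy σ ρ < ⊤) →
      ∀ ε : ℝ, 0 < ε → ∃ δ : ℝ → ℝ, Filter.Tendsto δ Filter.atTop (𝓝 0) ∧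
        ∀ (X : Type) [Countable X] (s : Strategy d X) (t : ℝ), 1 ≤ t →
          ENNReal.ofReal t ≤ s.falseAlarmTime ρ →
          (⨆ σ ∈ S, s.meanDelay ρ σ) ≤ ⨆ σ ∈ S, s.worstMeanDelay ρ σ ∧
          ENNReal.ofReal ((1 - ε) *
              (Real.log t / (S.inf' hS fun σ => relEntropy σ ρ).toReal) * (1 + δ t)) ≤
            ⨆ σ ∈ S, s.meanDelay ρ σ) := by
  refine ⟨fun σ hσ _ hD ε hε => ?_, fun S hS hmem ε hε => ?_⟩
  · obtain ⟨δ, hδ, h⟩ := exists_delay_bound hρ hσ hD hε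
    exact ⟨δ, hδ, fun X _ s t ht hT =>
      ⟨Strategy.meanDelay_le_worstMeanDelay hρ hσ, h X s t ht hT⟩⟩
  · obtain ⟨σ, hσS, hinf⟩ := S.exists_mem_eq_inf' hS fun σ => relEntropy σ ρ
    obtain ⟨hσ, -, hD⟩ := hmem σ hσS
    obtain ⟨δ, hδ, h⟩ := exists_delay_bound hρ hσ hD hε
    refine ⟨δ, hδ, fun X _ s t ht hT => ⟨?_, ?_⟩⟩
    · exact iSup₂_mono fun σ' hσ' => Strategy.meanDelay_le_worstMeanDelay hρ (hmem σ' hσ').1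
    · rw [hinf]
      exact (h X s t ht hT).trans (le_iSup₂ (f := fun σ (_ : σ ∈ S) => s.meanDelay ρ σ) σ hσS)
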